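/- Let $G$ be a locally compact abelian group whose topology is given by an invariant metric, denoted $|x-y|$. Let $(X,d)$ be a bounded metric space with its Borel $\sigma$-algebra and a probability measure $m$. Assume that $T:X\to X$ is a Young tower: there are a countable index set $I$ (for instance $I=\mathbb N$), integers $R_l\ge 1$ ($l\in I$) and a partition of $X$ into measurable sets $\Delta_{k,l}$, $l\in I$, $0\le k<R_l$, such that, with $\Delta_0:=\bigcup_{l}\Delta_{0,l}$, 1. for all $l$ and $k<R_l-1$, $T$ is a measurable isomorphism (a bijection, measurable together with its inverse) from $\Delta_{k,l}$ onto $\Delta_{k+1,l}$, preserving $m$; 2. for all $l$, $T$ is a measurable isomorphism from $\Delta_{R_l-1,l}$ onto $\Delta_0$; 3. there is $\lambda>1$ such that $d(T^{R_l}x,T^{R_l}y)\ge\lambda d(x,y)$ for all $l$ and all $x,y\in\Delta_{0,l}$; 4. there is $C>0$ such that $d(x,y)\le C\,d(T^{R_l-k}x,T^{R_l-k}y)$ for all $l$, all $k<R_l$ and all $x,y\in\Delta_{k,l}$; 5. on the sets $\Delta_{R_l-1,l}$ there is a positive measurable version $g$ of the density $\frac{dm|_{\Delta_{R_l-1,l}}}{d(m\circ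 T|_{\Delta_{R_l-1,l}})}$ (the inverse of the Jacobian of $T$), and a constant $C>0$, such that $\left|1-\frac{g(x)}{g(y)}\right|\le C\,d(Tx,Ty)$ for all $l$ and all $x,y\in\Delta_{R_l-1,l}$. The measure $m$ is not assumed to be $T$-invariant. For $f:X\to G$ and $Z\subset X$, let $Df(Z)\in[0,\infty]$ be the infimum of the $C>0$ for which there is $\Omega\subset Z$ with $m(Z\setminus\Omega)=0$ and $|f(x)-f(y)|\le C\,d(x,y)$ for all $x,y\in\Omega$ (with $\inf\emptyset=\infty$). Let $f:X\to G$ satisfy $$\sum_{l\in I}\sum_{k=0}^{R_l-1} m(\Delta_{k,l})\,Df(\Delta_{k,l})<\infty ,$$ and let $u:X\to G$ be a measurable function (it suffices that $u$ agrees almost everywhere with a Borel measurable function) such that $f=u-u\circ T$ almost everywhere. Then $u$ has a version which is Lipschitz on $\Delta_0$: there are a function $v:X\to G$ with $v=u$ almost everywhere and a constant $C>0$ such that $|v(x)-v(y)|\le C\,d(x,y)$ for all $x,y\in\Delta_0$. In particular $|u(x)-u(y)|\le C\,d(x,y)$ for all $x,y$ in a subset of full measure of $\Delta_0$. -/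

import Mathlib

open MeasureTheory Set
open scoped ENNReal

/-- `T` restricts to a measurable isomorphism from `A` onto `B`: a bijection that is measurable
together with its inverse. -/
structure IsMeasurableIsoOn {X : Type*} [MeasurableSpace X] (T : X → X) (A B : Set X) :
    Prop where
  bijOn : BijOn T A B
  measurableSet_preimage : ∀ S, MeasurableSet S → S ⊆ B → MeasurableSet (A ∩ T ⁻¹' S)
  measurableSet_image : ∀ S, MeasurableSet S → S ⊆ A → MeasurableSet (T '' S)

/-- The base `Δ₀ = ⋃ l, Δ_{0,l}` of a tower. -/
def towerBase {X ι : Type*} (Δ : ℕ → ι → Set X) : Set X := ⋃ l, Δ 0 l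

/-- Young towers. The set `Δ_{k,l}` is written `Δ k l`; only the indices with `k < R l` are
meaningful. The space `X` carries a metric, and its measurable sets are the Borel sets. -/
structure IsYoungTower {X ι : Type*} [MetricSpace X] [MeasurableSpace X]
    (T : X → X) (m : Measure X) (R : ι → ℕ) (Δ : ℕ → ι → Set X) : Prop where
  /-- The heights are positive integers. -/
  height_pos : ∀ l, 0 < R l
  /-- The sets `Δ_{k,l}`, for `k < R l`, form a measurable partition of `X`. -/
  measurableSet : ∀ l, ∀ k < R l, MeasurableSet (Δ k l)
  disjoint : ∀ l l', ∀ k < R l, ∀ k' < R l', (k, l) ≠ (k', l') → Disjoint (Δ k l) (Δ k' l')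
  cover : ∀ x, ∃ l, ∃ k < R l, x ∈ Δ k l
  /-- Below the top, `T` maps a level isomorphically to the next one and preserves `m`. -/
  up_iso : ∀ l k, k + 1 < R l → IsMeasurableIsoOn T (Δ k l) (Δ (k + 1) l)
  up_measure : ∀ l k, k + 1 < R l →
    ∀ A, MeasurableSet A → A ⊆ Δ k l → m (T '' A) = m A
  /-- `T` maps each top level isomorphically onto the base. -/
  top_iso : ∀ l, IsMeasurableIsoOn T (Δ (R l - 1) l) (towerBase Δ)
  /-- The returns to the base are uniformly expanding. -/
  expansion : ∃ lam : ℝ, 1 < lam ∧ ∀ l, ∀ x ∈ Δ 0 l, ∀ y ∈ Δ 0 l,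
    lam * dist x y ≤ dist (T^[R l] x) (T^[R l] y)
  /-- Distances inside a level are controlled by the distances at the next return. -/
  return_control : ∃ C : ℝ, 0 < C ∧ ∀ l, ∀ k < R l, ∀ x ∈ Δ k l, ∀ y ∈ Δ k l,
    dist x y ≤ C * dist (T^[R l - k] x) (T^[R l - k] y)
  /-- Bounded distortion: `g = dm / d(m ∘ T)` on the top levels, that is, `1 / g` is the
  Jacobian of `T` there. -/
  distortion : ∃ g : X → ℝ, Measurable g ∧
    (∀ l, ∀ x ∈ Δ (R l - 1) l, 0 < g x) ∧
    (∀ l, ∀ A, MeasurableSet A → A ⊆ Δ (R l - 1) l →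
      m (T '' A) = ∫⁻ x in A, ENNReal.ofReal (1 / g x) ∂m) ∧
    ∃ C : ℝ, 0 < C ∧ ∀ l, ∀ x ∈ Δ (R l - 1) l, ∀ y ∈ Δ (R l - 1) l,
      |1 - g x / g y| ≤ C * dist (T x) (T y)

/-- The essential Lipschitz constant `D f (Z)` of `f` on `Z`: the infimum of the `C > 0` such that
`f` is `C`-Lipschitz on a subset of `Z` of full measure (`∞` if there is none). -/
noncomputable def essLip {X G : Type*} [MetricSpace X] [MeasurableSpace X] [MetricSpace G]
    (m : Measure X) (f : X → G) (Z : Set X) : ℝ≥0∞ :=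
  sInf {c : ℝ≥0∞ | ∃ C : ℝ, 0 < C ∧ c = ENNReal.ofReal C ∧
    ∃ Ω ⊆ Z, m (Z \ Ω) = 0 ∧ ∀ x ∈ Ω, ∀ y ∈ Ω, dist (f x) (f y) ≤ C * dist x y}

/-! Pass to the return map `F` of the base. It has full branches `Δ 0 l`, contracting inverse
branches and bounded distortion. Summing `f` up a column telescopes to `u - u ∘ F`, so this
increment is Lipschitz on branch `l` with a constant `L l` measured against `dist (F x) (F y)`. All
levels of a column have the same mass, so the weighted sum of the `L l` converges
(`IsYoungTower.exists_lipschitz_version`).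

Iterating along a word `w` transports a bound on the oscillation of `u` from a cylinder to the whole
base, at the cost of a Lipschitz constant `discountedSum L ρ w` (`dist_iterate_le`). The `L l` may
be unbounded, so words must be selected. Let `B` be a set of positive measure where `u` is nearly
constant. Some cylinder is almost filled by `B`, but its discounted sum is uncontrolled. Appending
letters chosen by averaging keeps the defect of `B` small, while the factor `ρ` erases the initial
sum (`exists_cyl_diff_le_and_discountedSum_le`). By distortion, the image of `B` then almost fills
the base, and `u` is there `K`-Lipschitz up to a small error, with `K` independent of `B`.
Borel-Cantelli removes the error, and completeness of `G` extends the result from a full-measure set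
to the base.

Finding `B` requires `u` to be essentially separably valued, although `G` need not be separable.
This is `exists_countable_closure`, which rests on ergodicity of `F`. -/

open Filter Topology

/-! ### Measurable isomorphisms between sets. -/

section MeasurableIso

variable {X : Type*} [MeasurableSpace X] {T S : X → X} {A B E : Set X}

theorem IsMeasurableIsoOn.congr (h : IsMeasurableIsoOn T A B) (hTS : EqOn T S A) :
    IsMeasurableIsoOn S A B where
  bijOn := h.bijOn.congr hTS
  measurableSet_preimage D hD hDB := by
    have : A ∩ S ⁻¹' D = A ∩ T ⁻¹' D := by
      ext x
      simp only [mem_inter_iff, mem_preimage]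
      exact and_congr_right fun hx => by rw [hTS hx]
    rw [this]
    exact h.measurableSet_preimage D hD hDB
  measurableSet_image D hD hDA := by
    rw [← (hTS.mono hDA).image_eq]
    exact h.measurableSet_image D hD hDA

theorem IsMeasurableIsoOn.comp (hS : IsMeasurableIsoOn S B E) (hT : IsMeasurableIsoOn T A B) :
    IsMeasurableIsoOn (S ∘ T) A E where
  bijOn := hS.bijOn.comp hT.bijOn
  measurableSet_preimage D hD hDE := by
    have : A ∩ (S ∘ T) ⁻¹' D = A ∩ T ⁻¹' (B ∩ S ⁻¹' D) := by
      ext x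
      simp only [mem_inter_iff, mem_preimage, Function.comp]
      exact ⟨fun h => ⟨h.1, hT.bijOn.mapsTo h.1, h.2⟩, fun h => ⟨h.1, h.2.2⟩⟩
    rw [this]
    exact hT.measurableSet_preimage _ (hS.measurableSet_preimage D hD hDE) inter_subset_left
  measurableSet_image D hD hDA := by
    rw [image_comp]
    exact hS.measurableSet_image _ (hT.measurableSet_image D hD hDA)
      ((image_mono hDA).trans hT.bijOn.image_eq.subset)

theorem IsMeasurableIsoOn.restrict (h : IsMeasurableIsoOn T A B) (hE : MeasurableSet E)
    (hEB : E ⊆ B) : IsMeasurableIsoOn T (A ∩ T ⁻¹' E) E where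
  bijOn := by
    refine ⟨fun x hx => hx.2, h.bijOn.injOn.mono inter_subset_left, fun y hy => ?_⟩
    obtain ⟨x, hx, rfl⟩ := h.bijOn.surjOn (hEB hy)
    exact ⟨x, ⟨hx, hy⟩, rfl⟩
  measurableSet_preimage D hD hDE := by
    rw [inter_assoc, ← preimage_inter]
    exact h.measurableSet_preimage _ (hE.inter hD) (inter_subset_left.trans hEB)
  measurableSet_image D hD hDA := h.measurableSet_image D hD (hDA.trans inter_subset_left)

theorem isMeasurableIsoOn_id (hA : MeasurableSet A) : IsMeasurableIsoOn id A A where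
  bijOn := bijOn_id A
  measurableSet_preimage _ hD _ := hA.inter hD
  measurableSet_image D hD _ := by rwa [image_id]

end MeasurableIso

/-! ### Full-branched expanding maps: cylinders and distortion. -/

/-- A piecewise expanding map with full branches `a l` over the base `⋃ l, a l`: contraction
factor `ρ` of the inverse branches, distortion constant `C`, and `M` bounds the diameter. -/
structure IsFullMarkov {X ι : Type*} [MetricSpace X] [MeasurableSpace X]
    (F : X → X) (m : Measure X) (a : ι → Set X) (ρ C M : ℝ) : Prop where
  rate_pos : 0 < ρ
  rate_lt : ρ < 1
  distortion_nonneg : 0 ≤ C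
  diam_nonneg : 0 ≤ M
  dist_le : ∀ x y : X, dist x y ≤ M
  measurableSet : ∀ l, MeasurableSet (a l)
  disjoint : ∀ l l', l ≠ l' → Disjoint (a l) (a l')
  iso : ∀ l, IsMeasurableIsoOn F (a l) (⋃ l, a l)
  contraction : ∀ l, ∀ x ∈ a l, ∀ y ∈ a l, dist x y ≤ ρ * dist (F x) (F y)
  distortion : ∀ l, ∀ A B, MeasurableSet A → MeasurableSet B → A ⊆ a l → B ⊆ a l →
    ∀ δ : ℝ, 0 ≤ δ → (∀ x ∈ A, ∀ y ∈ B, dist (F x) (F y) ≤ δ) →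
    m.real A * m.real (F '' B) ≤ (1 + C * δ) * (m.real B * m.real (F '' A))
  null_image : ∀ l, ∀ A, MeasurableSet A → A ⊆ a l → (m (F '' A) = 0 ↔ m A = 0)
  base_pos : m (⋃ l, a l) ≠ 0

/-- Cylinder sets of a piecewise defined map. -/
def cyl {X ι : Type*} (F : X → X) (a : ι → Set X) : List ι → Set X
  | [] => ⋃ l, a l
  | l :: w => a l ∩ F ⁻¹' cyl F a w

/-- The discounted sum `∑ j, L (w j) * ρ ^ (n - 1 - j)` along a word of length `n`. -/
def discountedSum {ι : Type*} (L : ι → ℝ) (ρ : ℝ) : List ι → ℝ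
  | [] => 0
  | l :: w => L l * ρ ^ w.length + discountedSum L ρ w

theorem discountedSum_concat {ι : Type*} (L : ι → ℝ) (ρ : ℝ) (w : List ι) (l : ι) :
    discountedSum L ρ (w ++ [l]) = ρ * discountedSum L ρ w + L l := by
  induction w with
  | nil => simp [discountedSum]
  | cons k w ih =>
    simp only [List.cons_append, discountedSum, ih, List.length_append, List.length_singleton]
    ring

theorem discountedSum_nonneg {ι : Type*} {L : ι → ℝ} {ρ : ℝ} (hL : ∀ l, 0 ≤ L l) (hρ : 0 ≤ ρ)
    (w : List ι) : 0 ≤ discountedSum L ρ w := by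
  induction w with
  | nil => exact le_rfl
  | cons k w ih => exact add_nonneg (mul_nonneg (hL k) (pow_nonneg hρ _)) ih

theorem geom_partial_sum_le {ρ : ℝ} (h0 : 0 < ρ) (h1 : ρ < 1) (n : ℕ) :
    ∑ i ∈ Finset.range n, ρ ^ i ≤ (1 - ρ)⁻¹ := by
  rw [← tsum_geometric_of_lt_one h0.le h1]
  exact (summable_geometric_of_lt_one h0.le h1).sum_le_tsum _ fun i _ => pow_nonneg h0.le i

theorem cyl_subset_base {X ι : Type*} {F : X → X} {a : ι → Set X} (w : List ι) :
    cyl F a w ⊆ ⋃ l, a l := by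
  cases w with
  | nil => exact subset_rfl
  | cons l w => exact inter_subset_left.trans (subset_iUnion a l)

theorem cyl_append {X ι : Type*} {F : X → X} {a : ι → Set X} (w v : List ι) :
    cyl F a (w ++ v) = cyl F a w ∩ F^[w.length] ⁻¹' cyl F a v := by
  induction w with
  | nil => exact (inter_eq_right.2 (cyl_subset_base v)).symm
  | cons l w ih =>
    simp only [List.cons_append, cyl, ih, preimage_inter, List.length_cons,
      Function.iterate_succ, preimage_comp, inter_assoc]

namespace IsFullMarkov

variable {X ι : Type*} [MetricSpace X] [MeasurableSpace X]
  {F : X → X} {m : Measure X} {a : ι → Set X} {ρ C M : ℝ}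

theorem mapsTo_base (h : IsFullMarkov F m a ρ C M) {x : X} (hx : x ∈ ⋃ l, a l) :
    F x ∈ ⋃ l, a l := by
  obtain ⟨l, hl⟩ := mem_iUnion.1 hx
  exact (h.iso l).bijOn.mapsTo hl

theorem iterate_mem_base (h : IsFullMarkov F m a ρ C M) {x : X} (hx : x ∈ ⋃ l, a l) (n : ℕ) :
    F^[n] x ∈ ⋃ l, a l := by
  induction n with
  | zero => exact hx
  | succ n ih =>
    rw [Function.iterate_succ_apply']
    exact h.mapsTo_base ih

theorem measurableSet_base [Countable ι] (h : IsFullMarkov F m a ρ C M) :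
    MeasurableSet (⋃ l, a l) := MeasurableSet.iUnion h.measurableSet

theorem measurableSet_cyl [Countable ι] (h : IsFullMarkov F m a ρ C M) (w : List ι) :
    MeasurableSet (cyl F a w) := by
  induction w with
  | nil => exact h.measurableSet_base
  | cons l w ih => exact (h.iso l).measurableSet_preimage _ ih (cyl_subset_base w)

theorem iso_cyl [Countable ι] (h : IsFullMarkov F m a ρ C M) (w : List ι) :
    IsMeasurableIsoOn F^[w.length] (cyl F a w) (⋃ l, a l) := by
  induction w with
  | nil => exact isMeasurableIsoOn_id h.measurableSet_base
  | cons l w ih =>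
    exact ih.comp ((h.iso l).restrict (h.measurableSet_cyl w) (cyl_subset_base w))

theorem dist_le_of_mem_cyl (h : IsFullMarkov F m a ρ C M) (w : List ι) :
    ∀ x ∈ cyl F a w, ∀ y ∈ cyl F a w,
      dist x y ≤ ρ ^ w.length * dist (F^[w.length] x) (F^[w.length] y) := by
  induction w with
  | nil => intro x _ y _; simp
  | cons l w ih =>
    intro x hx y hy
    calc dist x y ≤ ρ * dist (F x) (F y) := h.contraction l x hx.1 y hy.1
      _ ≤ ρ * (ρ ^ w.length * dist (F^[w.length] (F x)) (F^[w.length] (F y))) :=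
        mul_le_mul_of_nonneg_left (ih _ hx.2 _ hy.2) h.rate_pos.le
      _ = _ := by
        rw [List.length_cons, pow_succ', Function.iterate_succ_apply,
          Function.iterate_succ_apply, mul_assoc]

theorem dist_le_pow_of_mem_cyl (h : IsFullMarkov F m a ρ C M) (w : List ι) {x y : X}
    (hx : x ∈ cyl F a w) (hy : y ∈ cyl F a w) : dist x y ≤ ρ ^ w.length * M :=
  (h.dist_le_of_mem_cyl w x hx y hy).trans
    (mul_le_mul_of_nonneg_left (h.dist_le _ _) (pow_nonneg h.rate_pos.le _))

theorem cyl_concat (h : IsFullMarkov F m a ρ C M) (w : List ι) (l : ι) :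
    cyl F a (w ++ [l]) = cyl F a w ∩ F^[w.length] ⁻¹' a l := by
  have hl : cyl F a [l] = a l :=
    inter_eq_left.2 fun x hx => (h.iso l).bijOn.mapsTo hx
  rw [cyl_append, hl]

theorem cyl_concat_subset (h : IsFullMarkov F m a ρ C M) (w : List ι) (l : ι) :
    cyl F a (w ++ [l]) ⊆ cyl F a w := by
  rw [h.cyl_concat]; exact inter_subset_left

theorem iUnion_cyl_concat (h : IsFullMarkov F m a ρ C M) (w : List ι) :
    ⋃ l, cyl F a (w ++ [l]) = cyl F a w := by
  simp only [h.cyl_concat, ← inter_iUnion, ← preimage_iUnion]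
  exact inter_eq_left.2 fun x hx => h.iterate_mem_base (cyl_subset_base w hx) _

theorem disjoint_cyl_concat (h : IsFullMarkov F m a ρ C M) (w : List ι) {l l' : ι}
    (hl : l ≠ l') : Disjoint (cyl F a (w ++ [l])) (cyl F a (w ++ [l'])) := by
  rw [h.cyl_concat, h.cyl_concat]
  exact ((h.disjoint l l' hl).preimage _).mono inter_subset_right inter_subset_right

theorem disjoint_cyl (h : IsFullMarkov F m a ρ C M) (w : List ι) :
    ∀ v : List ι, w.length = v.length → w ≠ v → Disjoint (cyl F a w) (cyl F a v) := by
  induction w with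
  | nil => intro v hv hne; exact absurd (List.length_eq_zero_iff.1 hv.symm).symm hne
  | cons l w ih =>
    rintro (_ | ⟨k, v⟩) hv hne
    · simp at hv
    · by_cases hlk : l = k
      · subst hlk
        have : w ≠ v := fun e => hne (by rw [e])
        exact ((ih v (by simpa using hv) this).preimage F).mono inter_subset_right
          inter_subset_right
      · exact (h.disjoint l k hlk).mono inter_subset_left inter_subset_left

theorem exists_mem_cyl (h : IsFullMarkov F m a ρ C M) (n : ℕ) :
    ∀ x ∈ ⋃ l, a l, ∃ w : List ι, w.length = n ∧ x ∈ cyl F a w := by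
  induction n with
  | zero => intro x hx; exact ⟨[], rfl, hx⟩
  | succ n ih =>
    intro x hx
    obtain ⟨w, hw, hxw⟩ := ih _ (h.mapsTo_base hx)
    obtain ⟨l, hl⟩ := mem_iUnion.1 hx
    exact ⟨l :: w, by simp [hw], hl, hxw⟩

theorem cyl_null_image [Countable ι] (h : IsFullMarkov F m a ρ C M) (w : List ι) :
    ∀ A, MeasurableSet A → A ⊆ cyl F a w → (m (F^[w.length] '' A) = 0 ↔ m A = 0) := by
  induction w with
  | nil => intro A _ _; simp
  | cons l w ih =>
    intro A hA hAw
    have hAl : A ⊆ a l := hAw.trans inter_subset_left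
    rw [List.length_cons, Function.iterate_succ, image_comp,
      ih _ ((h.iso l).measurableSet_image A hA hAl) (image_subset_iff.2 fun x hx => (hAw hx).2),
      h.null_image l A hA hAl]

theorem measure_cyl_ne_zero [Countable ι] (h : IsFullMarkov F m a ρ C M) (w : List ι) :
    m (cyl F a w) ≠ 0 := by
  rw [ne_eq, ← h.cyl_null_image w _ (h.measurableSet_cyl w) subset_rfl,
    (h.iso_cyl w).bijOn.image_eq]
  exact h.base_pos

theorem measureReal_cyl_pos [Countable ι] [IsFiniteMeasure m] (h : IsFullMarkov F m a ρ C M)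
    (w : List ι) : 0 < m.real (cyl F a w) :=
  ENNReal.toReal_pos (h.measure_cyl_ne_zero w) (measure_ne_top m _)

theorem measureReal_base_pos [IsFiniteMeasure m] (h : IsFullMarkov F m a ρ C M) :
    0 < m.real (⋃ l, a l) :=
  ENNReal.toReal_pos h.base_pos (measure_ne_top m _)

/-- The first letter of `l :: w` costs a factor `1 + C * δ`, where `δ = ρ ^ w.length * M` bounds the
diameter of the cylinder containing the images under `F`. Bounding each factor by an exponential
turns the product into a geometric sum in the exponent. -/
theorem distortion_cyl_partial [Countable ι] [IsFiniteMeasure m] (h : IsFullMarkov F m a ρ C M)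
    (w : List ι) : ∀ A B, MeasurableSet A → MeasurableSet B → A ⊆ cyl F a w → B ⊆ cyl F a w →
      m.real A * m.real (F^[w.length] '' B) ≤
        Real.exp (C * M * ∑ i ∈ Finset.range w.length, ρ ^ i) *
          (m.real B * m.real (F^[w.length] '' A)) := by
  induction w with
  | nil => intro A B _ _ _ _; simp [mul_comm]
  | cons l w ih =>
    intro A B hA hB hAw hBw
    have hAl : A ⊆ a l := hAw.trans inter_subset_left
    have hBl : B ⊆ a l := hBw.trans inter_subset_left
    have hAc : F '' A ⊆ cyl F a w := image_subset_iff.2 fun x hx => (hAw hx).2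
    have hBc : F '' B ⊆ cyl F a w := image_subset_iff.2 fun x hx => (hBw hx).2
    have hFA := (h.iso l).measurableSet_image A hA hAl
    have hFB := (h.iso l).measurableSet_image B hB hBl
    have h1 := ih _ _ hFA hFB hAc hBc
    have hδ : 0 ≤ ρ ^ w.length * M := mul_nonneg (pow_nonneg h.rate_pos.le _) h.diam_nonneg
    have h2 := h.distortion l A B hA hB hAl hBl _ hδ fun x hx y hy =>
      h.dist_le_pow_of_mem_cyl w (hAc (mem_image_of_mem F hx)) (hBc (mem_image_of_mem F hy))
    have h3 : 1 + C * (ρ ^ w.length * M) ≤ Real.exp (C * M * ρ ^ w.length) := by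
      have := Real.add_one_le_exp (C * M * ρ ^ w.length)
      linarith
    rw [List.length_cons, Function.iterate_succ, image_comp, image_comp, Finset.sum_range_succ,
      mul_add, Real.exp_add]
    set e₁ := Real.exp (C * M * ∑ i ∈ Finset.range w.length, ρ ^ i)
    set e₂ := Real.exp (C * M * ρ ^ w.length)
    have he₁ : 0 < e₁ := Real.exp_pos _
    have he₂ : 0 < e₂ := Real.exp_pos _
    have h2' : m.real A * m.real (F '' B) ≤ e₂ * (m.real B * m.real (F '' A)) :=
      h2.trans (mul_le_mul_of_nonneg_right h3 (by positivity))
    -- Null images are treated separately because the chain below cancels `m.real (F '' A) * m.real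
    -- (F '' B)`.
    rcases eq_or_ne (m (F '' A)) 0 with hA0 | hA0
    · have : m A = 0 := (h.null_image l A hA hAl).1 hA0
      rw [measureReal_def m A, this, ENNReal.toReal_zero, zero_mul]
      positivity
    rcases eq_or_ne (m (F '' B)) 0 with hB0 | hB0
    · have : m (F^[w.length] '' (F '' B)) = 0 := (h.cyl_null_image w _ hFB hBc).2 hB0
      rw [measureReal_def m (F^[w.length] '' (F '' B)), this, ENNReal.toReal_zero, mul_zero]
      positivity
    have pA : 0 < m.real (F '' A) := ENNReal.toReal_pos hA0 (measure_ne_top m _)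
    have pB : 0 < m.real (F '' B) := ENNReal.toReal_pos hB0 (measure_ne_top m _)
    refine le_of_mul_le_mul_right ?_ (mul_pos pA pB)
    calc m.real A * m.real (F^[w.length] '' (F '' B)) * (m.real (F '' A) * m.real (F '' B))
        = (m.real A * m.real (F '' B)) *
            (m.real (F '' A) * m.real (F^[w.length] '' (F '' B))) := by ring
      _ ≤ (e₂ * (m.real B * m.real (F '' A))) *
            (e₁ * (m.real (F '' B) * m.real (F^[w.length] '' (F '' A)))) :=
          mul_le_mul h2' h1 (by positivity) (by positivity)
      _ = _ := by ring

/-- Bounded distortion, uniformly over all cylinders. -/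
theorem exists_distortion_cyl [Countable ι] [IsFiniteMeasure m] (h : IsFullMarkov F m a ρ C M) :
    ∃ D : ℝ, 0 < D ∧ ∀ w : List ι, ∀ A B, MeasurableSet A → MeasurableSet B →
      A ⊆ cyl F a w → B ⊆ cyl F a w →
      m.real A * m.real (F^[w.length] '' B) ≤ D * (m.real B * m.real (F^[w.length] '' A)) := by
  refine ⟨Real.exp (C * M * (1 - ρ)⁻¹), Real.exp_pos _, fun w A B hA hB hAw hBw => ?_⟩
  refine (h.distortion_cyl_partial w A B hA hB hAw hBw).trans
    (mul_le_mul_of_nonneg_right (Real.exp_le_exp.2 ?_) (by positivity))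
  exact mul_le_mul_of_nonneg_left (geom_partial_sum_le h.rate_pos h.rate_lt _)
    (mul_nonneg h.distortion_nonneg h.diam_nonneg)

theorem exists_pow_mul_lt (h : IsFullMarkov F m a ρ C M) {K ε : ℝ} (hε : 0 < ε) :
    ∃ n : ℕ, ρ ^ n * K < ε := by
  have : Tendsto (fun n : ℕ => ρ ^ n * K) atTop (𝓝 (0 * K)) :=
    (tendsto_pow_atTop_nhds_zero_of_lt_one h.rate_pos.le h.rate_lt).mul_const K
  rw [zero_mul] at this
  exact (this.eventually (gt_mem_nhds hε)).exists

/-- Contraction bounds the distance after `j + 1` steps by `ρ ^ (n - 1 - j)` times the distance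
after `n` steps. The letter `w j` therefore enters with exactly its weight in `discountedSum`. -/
theorem dist_iterate_le {G : Type*} [NormedAddCommGroup G]
    (h : IsFullMarkov F m a ρ C M) {L : ι → ℝ} {u : X → G} {Z : Set X}
    (hZF : ∀ x ∈ Z, F x ∈ Z)
    (hu : ∀ l, ∀ x ∈ a l ∩ Z, ∀ y ∈ a l ∩ Z,
      dist (u x - u (F x)) (u y - u (F y)) ≤ L l * dist (F x) (F y))
    (hL : ∀ l, 0 ≤ L l) (w : List ι) :
    ∀ x ∈ cyl F a w ∩ Z, ∀ y ∈ cyl F a w ∩ Z,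
      dist (u (F^[w.length] x)) (u (F^[w.length] y)) ≤ dist (u x) (u y) +
        discountedSum L ρ w * dist (F^[w.length] x) (F^[w.length] y) := by
  induction w with
  | nil => intro x _ y _; simp [discountedSum]
  | cons l w ih =>
    rintro x ⟨hxw, hxZ⟩ y ⟨hyw, hyZ⟩
    have h1 := ih (F x) ⟨hxw.2, hZF x hxZ⟩ (F y) ⟨hyw.2, hZF y hyZ⟩
    have h2 := hu l x ⟨hxw.1, hxZ⟩ y ⟨hyw.1, hyZ⟩
    have h3 := mul_le_mul_of_nonneg_left (h.dist_le_of_mem_cyl w _ hxw.2 _ hyw.2) (hL l)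
    have h4 : dist (u (F x)) (u (F y)) ≤
        dist (u x) (u y) + dist (u x - u (F x)) (u y - u (F y)) := by
      simp only [dist_eq_norm]
      calc ‖u (F x) - u (F y)‖
          = ‖(u x - u y) - ((u x - u (F x)) - (u y - u (F y)))‖ := by congr 1; abel
        _ ≤ _ := norm_sub_le _ _
    simp only [List.length_cons, Function.iterate_succ_apply, discountedSum]
    linarith

end IsFullMarkov

/-! ### Density of cylinders and ergodicity. -/

namespace IsFullMarkov

variable {X ι : Type*} [MetricSpace X] [MeasurableSpace X] [Countable ι]
  {F : X → X} {m : Measure X} {a : ι → Set X} {ρ C M : ℝ}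

theorem measure_iUnion_cyl_inter (h : IsFullMarkov F m a ρ C M) (n : ℕ) (P : List ι → Prop)
    {B : Set X} (hB : MeasurableSet B) :
    m ((⋃ w : {w : List ι // w.length = n ∧ P w}, cyl F a w) ∩ B) =
      ∑' w : {w : List ι // w.length = n ∧ P w}, m (cyl F a w ∩ B) := by
  rw [iUnion_inter]
  refine measure_iUnion (fun w v hwv => ?_) fun w => (h.measurableSet_cyl _).inter hB
  exact (h.disjoint_cyl w.1 v.1 (w.2.1.trans v.2.1.symm)
    fun e => hwv (Subtype.ext e)).mono inter_subset_left inter_subset_left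

/-- Every set of positive measure in the base fills an arbitrarily large proportion of some
cylinder. -/
theorem exists_mul_measure_cyl_lt [BorelSpace X] [IsFiniteMeasure m]
    (h : IsFullMarkov F m a ρ C M) {B : Set X} (hB : MeasurableSet B) (hBY : B ⊆ ⋃ l, a l)
    (hB0 : m B ≠ 0) {θ : ℝ≥0∞} (hθ : θ < 1) :
    ∃ w : List ι, θ * m (cyl F a w) < m (cyl F a w ∩ B) := by
  by_contra! hcon
  -- This replaces the Lebesgue density theorem. The cylinders of length `n` inside `U` are disjoint
  -- and exhaust `B` as `n` grows, since their diameters tend to `0`. Outer regularity then gives `m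
  -- B ≤ θ * m B`.
  have key : ∀ U, IsOpen U → B ⊆ U → m B ≤ θ * m U := by
    intro U hU hBU
    let V : ℕ → Set X := fun n =>
      ⋃ w : {w : List ι // w.length = n ∧ cyl F a w ⊆ U}, cyl F a w
    have hVB : ∀ n, m (V n ∩ B) ≤ θ * m U := by
      intro n
      have h1 := h.measure_iUnion_cyl_inter n (fun w => cyl F a w ⊆ U) hB
      have h2 := h.measure_iUnion_cyl_inter n (fun w => cyl F a w ⊆ U) MeasurableSet.univ
      simp only [inter_univ] at h2
      have hVU : V n ⊆ U := iUnion_subset fun w => w.2.2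
      calc m (V n ∩ B) = ∑' w : {w : List ι // w.length = n ∧ cyl F a w ⊆ U},
            m (cyl F a w ∩ B) := h1
        _ ≤ ∑' w : {w : List ι // w.length = n ∧ cyl F a w ⊆ U}, θ * m (cyl F a w) :=
            ENNReal.tsum_le_tsum fun w => hcon w
        _ = θ * m (V n) := by rw [ENNReal.tsum_mul_left, ← h2]
        _ ≤ θ * m U := by gcongr
    have hmono : Monotone fun n => V n ∩ B := by
      refine monotone_nat_of_le_succ fun n x hx => ⟨?_, hx.2⟩
      obtain ⟨⟨w, hw, hwU⟩, hxw⟩ := mem_iUnion.1 hx.1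
      have hxw : x ∈ cyl F a w := hxw
      rw [← h.iUnion_cyl_concat] at hxw
      obtain ⟨l, hl⟩ := mem_iUnion.1 hxw
      exact mem_iUnion.2 ⟨⟨w ++ [l], by simp [hw], (h.cyl_concat_subset w l).trans hwU⟩, hl⟩
    have hcover : B ⊆ ⋃ n, V n ∩ B := by
      intro x hx
      obtain ⟨ε, hε, hεU⟩ := Metric.isOpen_iff.1 hU x (hBU hx)
      obtain ⟨n, hn⟩ := h.exists_pow_mul_lt (K := M) hε
      obtain ⟨w, hw, hxw⟩ := h.exists_mem_cyl n x (hBY hx)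
      refine mem_iUnion.2 ⟨n, mem_iUnion.2 ⟨⟨w, hw, fun y hy => hεU ?_⟩, hxw⟩, hx⟩
      rw [← hw] at hn
      exact (h.dist_le_pow_of_mem_cyl w hy hxw).trans_lt hn
    calc m B ≤ m (⋃ n, V n ∩ B) := measure_mono hcover
      _ = ⨆ n, m (V n ∩ B) := hmono.measure_iUnion
      _ ≤ θ * m U := iSup_le hVB
  have hle : m B ≤ θ * m B := by
    rcases eq_or_ne θ 0 with rfl | hθ0
    · simpa using key univ isOpen_univ (subset_univ B)
    have hθt : θ ≠ ∞ := ne_top_of_lt hθ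
    rw [← ENNReal.div_le_iff' hθ0 hθt, B.measure_eq_iInf_isOpen m]
    refine le_iInf₂ fun U hBU => le_iInf fun hU => ?_
    rw [← B.measure_eq_iInf_isOpen m, ENNReal.div_le_iff' hθ0 hθt]
    exact key U hU hBU
  have hlt : θ * m B < 1 * m B :=
    ENNReal.mul_lt_mul_left hB0 (measure_ne_top m B) hθ
  rw [one_mul] at hlt
  exact absurd hle (not_le.2 hlt)

theorem exists_measureReal_cyl_diff_le [BorelSpace X] [IsFiniteMeasure m]
    (h : IsFullMarkov F m a ρ C M) {B : Set X} (hB : MeasurableSet B) (hBY : B ⊆ ⋃ l, a l)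
    (hB0 : m B ≠ 0) {η : ℝ} (hη : 0 < η) :
    ∃ w : List ι, m.real (cyl F a w \ B) ≤ η * m.real (cyl F a w) := by
  have hθ : ENNReal.ofReal (1 - η) < 1 := by
    rw [← ENNReal.ofReal_one, ENNReal.ofReal_lt_ofReal_iff one_pos]
    linarith
  obtain ⟨w, hw⟩ := h.exists_mul_measure_cyl_lt hB hBY hB0 hθ
  refine ⟨w, ?_⟩
  have h1 := (ENNReal.toReal_lt_toReal (ENNReal.mul_ne_top ENNReal.ofReal_ne_top
    (measure_ne_top m _)) (measure_ne_top m _)).2 hw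
  rw [ENNReal.toReal_mul] at h1
  have h2 : 1 - η ≤ (ENNReal.ofReal (1 - η)).toReal := 
    (le_max_left _ _).trans_eq ENNReal.toReal_ofReal'.symm
  have h3 := measureReal_inter_add_sdiff (μ := m) (s := cyl F a w) hB
  have h4 := mul_le_mul_of_nonneg_right h2 (measureReal_nonneg (μ := m) (s := cyl F a w))
  simp only [measureReal_def] at *
  linarith

theorem hasSum_measureReal_cyl_concat [IsFiniteMeasure m] (h : IsFullMarkov F m a ρ C M)
    (w : List ι) {B : Set X} (hB : MeasurableSet B) :
    HasSum (fun l => m.real (cyl F a (w ++ [l]) ∩ B)) (m.real (cyl F a w ∩ B)) := by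
  have h1 : m (cyl F a w ∩ B) = ∑' l, m (cyl F a (w ++ [l]) ∩ B) := by
    rw [← h.iUnion_cyl_concat w, iUnion_inter]
    exact measure_iUnion (fun l l' hl => (h.disjoint_cyl_concat w hl).mono inter_subset_left
      inter_subset_left) fun l => (h.measurableSet_cyl _).inter hB
  have h2 : ∑' l, m (cyl F a (w ++ [l]) ∩ B) ≠ ∞ := h1 ▸ measure_ne_top m _
  rw [measureReal_def, h1, ENNReal.tsum_toReal_eq fun l => measure_ne_top m _]
  exact (ENNReal.summable_toReal h2).hasSum

/-- The image of a set of small relative complement in a cylinder has small complement in the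
base. -/
theorem measureReal_base_diff_image_le [IsFiniteMeasure m] (h : IsFullMarkov F m a ρ C M) {D : ℝ}
    (hD : ∀ w : List ι, ∀ A B, MeasurableSet A → MeasurableSet B →
      A ⊆ cyl F a w → B ⊆ cyl F a w →
      m.real A * m.real (F^[w.length] '' B) ≤ D * (m.real B * m.real (F^[w.length] '' A)))
    (hD0 : 0 < D) (w : List ι) {A : Set X} (hA : MeasurableSet A) {η : ℝ}
    (hη : m.real (cyl F a w \ A) ≤ η * m.real (cyl F a w)) :
    m.real ((⋃ l, a l) \ F^[w.length] '' (cyl F a w ∩ A)) ≤ D * η * m.real (⋃ l, a l) := by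
  have hw := h.measurableSet_cyl w
  have himg : F^[w.length] '' (cyl F a w \ A) =
      (⋃ l, a l) \ F^[w.length] '' (cyl F a w ∩ A) := by
    rw [← (h.iso_cyl w).bijOn.image_eq,
      ← (h.iso_cyl w).bijOn.injOn.image_sdiff_subset inter_subset_left, sdiff_self_inter]
  have h1 := hD w (cyl F a w) (cyl F a w \ A) hw (hw.diff hA) subset_rfl sdiff_subset
  rw [himg, (h.iso_cyl w).bijOn.image_eq] at h1
  have hpos := h.measureReal_cyl_pos w
  refine le_of_mul_le_mul_left (h1.trans ?_) hpos
  calc D * (m.real (cyl F a w \ A) * m.real (⋃ l, a l))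
      ≤ D * (η * m.real (cyl F a w) * m.real (⋃ l, a l)) := by gcongr
    _ = _ := by ring

/-- `F` pulls null subsets of the base back to null sets: each branch does, and there are countably
many. -/
theorem ae_comp [IsFiniteMeasure m] (h : IsFullMarkov F m a ρ C M) {p : X → Prop}
    (hp : ∀ᵐ x ∂m, x ∈ (⋃ l, a l) → p x) : ∀ᵐ x ∂m, x ∈ (⋃ l, a l) → p (F x) := by
  obtain ⟨N, hN, hNm, hN0⟩ := exists_measurable_superset_of_null (ae_iff.1 hp)
  have hnull : ∀ l, m (a l ∩ F ⁻¹' (N ∩ ⋃ l, a l)) = 0 := by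
    intro l
    have hE : MeasurableSet (N ∩ ⋃ l, a l) := hNm.inter h.measurableSet_base
    rw [← h.null_image l _ ((h.iso l).measurableSet_preimage _ hE inter_subset_right)
      inter_subset_left, ((h.iso l).restrict hE inter_subset_right).bijOn.image_eq]
    exact measure_mono_null inter_subset_left hN0
  rw [ae_iff]
  refine measure_mono_null (fun x hx => ?_) (measure_iUnion_null hnull)
  simp only [mem_ofPred_eq, Classical.not_imp] at hx
  obtain ⟨l, hl⟩ := mem_iUnion.1 hx.1
  have hFx := h.mapsTo_base hx.1
  refine mem_iUnion.2 ⟨l, hl, hN ?_, hFx⟩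
  simp only [mem_ofPred_eq, Classical.not_imp]
  exact ⟨hFx, hx.2⟩

theorem ae_comp_iterate [IsFiniteMeasure m] (h : IsFullMarkov F m a ρ C M) {p : X → Prop}
    (hp : ∀ᵐ x ∂m, x ∈ (⋃ l, a l) → p x) (n : ℕ) :
    ∀ᵐ x ∂m, x ∈ (⋃ l, a l) → p (F^[n] x) := by
  induction n with
  | zero => exact hp
  | succ n ih => simpa only [Function.iterate_succ_apply] using h.ae_comp ih

/-- Ergodicity of the map on its base. -/
theorem measure_base_diff_eq_zero [BorelSpace X] [IsFiniteMeasure m]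
    (h : IsFullMarkov F m a ρ C M)
    {B : Set X} (hB : MeasurableSet B) (hBY : B ⊆ ⋃ l, a l) (hB0 : m B ≠ 0)
    (hinv : ∀ᵐ x ∂m, x ∈ (⋃ l, a l) → (x ∈ B ↔ F x ∈ B)) : m ((⋃ l, a l) \ B) = 0 := by
  obtain ⟨D, hD0, hD⟩ := h.exists_distortion_cyl
  have hinv' : ∀ n, ∀ᵐ x ∂m, x ∈ (⋃ l, a l) → (x ∈ B ↔ F^[n] x ∈ B) := by
    intro n
    induction n with
    | zero => simp
    | succ n ih =>
      filter_upwards [ih, h.ae_comp_iterate hinv n] with x h1 h2 hx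
      rw [h1 hx, h2 hx, Function.iterate_succ_apply']
  have key : ∀ η > 0, m.real ((⋃ l, a l) \ B) ≤ D * η * m.real (⋃ l, a l) := by
    intro η hη
    obtain ⟨w, hw⟩ := h.exists_measureReal_cyl_diff_le hB hBY hB0 hη
    have hiso := (h.iso_cyl w).restrict hB hBY
    have hA := (h.iso_cyl w).measurableSet_preimage _ hB hBY
    have himg : F^[w.length] '' (cyl F a w ∩ (cyl F a w ∩ F^[w.length] ⁻¹' B)) = B := by
      rw [← inter_assoc, inter_self]
      exact hiso.bijOn.image_eq
    -- Almost invariance identifies `B` with its preimage under the iterate up to a null set, so the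
    -- preimage inherits the small defect, while its image is `B` itself.
    have hdiff : m.real (cyl F a w \ (cyl F a w ∩ F^[w.length] ⁻¹' B)) =
        m.real (cyl F a w \ B) := by
      refine measureReal_congr ?_
      filter_upwards [hinv' w.length] with x hx
      refine propext ?_
      change (x ∈ cyl F a w ∧ ¬ (x ∈ cyl F a w ∧ F^[w.length] x ∈ B)) ↔
        (x ∈ cyl F a w ∧ ¬ x ∈ B)
      constructor
      · exact fun hh => ⟨hh.1, fun hb => hh.2 ⟨hh.1, (hx (cyl_subset_base w hh.1)).1 hb⟩⟩
      · exact fun hh => ⟨hh.1, fun hb => hh.2 ((hx (cyl_subset_base w hh.1)).2 hb.2)⟩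
    have := h.measureReal_base_diff_image_le hD hD0 w hA (hdiff.trans_le hw)
    rwa [himg] at this
  have hpos : 0 < D * m.real (⋃ l, a l) := mul_pos hD0 h.measureReal_base_pos
  have hzero : m.real ((⋃ l, a l) \ B) ≤ 0 := by
    refine le_of_forall_pos_le_add fun ε hε => ?_
    refine (key (ε / (D * m.real (⋃ l, a l))) (by positivity)).trans_eq ?_
    have := h.measureReal_base_pos
    field_simp
    simp
  exact (measureReal_eq_zero_iff (measure_ne_top m _)).1 (le_antisymm hzero measureReal_nonneg)

/-! ### Selecting words by averaging. -/

/-- Averaging over the one-letter extensions of a word. -/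
theorem exists_concat_le [IsFiniteMeasure m] (h : IsFullMarkov F m a ρ C M) {D : ℝ}
    (hD : ∀ w : List ι, ∀ A B, MeasurableSet A → MeasurableSet B →
      A ⊆ cyl F a w → B ⊆ cyl F a w →
      m.real A * m.real (F^[w.length] '' B) ≤ D * (m.real B * m.real (F^[w.length] '' A)))
    {L : ι → ℝ} (hL : ∀ l, 0 ≤ L l) (hsum : Summable fun l => m.real (a l) * L l)
    {B : Set X} (hB : MeasurableSet B) (p : ℝ) {q : ℝ} (hq : 0 ≤ q) (w : List ι) :
    ∃ l, p * (m.real (cyl F a (w ++ [l]) \ B) / m.real (cyl F a (w ++ [l]))) +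
        q * discountedSum L ρ (w ++ [l]) ≤
      p * (m.real (cyl F a w \ B) / m.real (cyl F a w)) +
        q * (ρ * discountedSum L ρ w + D * (∑' l, m.real (a l) * L l) / m.real (⋃ l, a l)) := by
  set K := D * (∑' l, m.real (a l) * L l) / m.real (⋃ l, a l) with hK
  set Z := p * (m.real (cyl F a w \ B) / m.real (cyl F a w)) +
    q * (ρ * discountedSum L ρ w + K) with hZ
  -- If every letter exceeded the bound, weighting by the measures of the extended cylinders and
  -- summing would give a strict inequality between two equal totals.
  by_contra! hcon
  have hY := h.measureReal_base_pos
  have hw := h.measureReal_cyl_pos w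
  have hμ : HasSum (fun l => m.real (cyl F a (w ++ [l]))) (m.real (cyl F a w)) := by
    simpa using h.hasSum_measureReal_cyl_concat w MeasurableSet.univ
  have hμB : HasSum (fun l => m.real (cyl F a (w ++ [l]) \ B)) (m.real (cyl F a w \ B)) :=
    h.hasSum_measureReal_cyl_concat w hB.compl
  -- Distortion makes the relative mass of letter `l` inside `cyl F a w` at most `D` times its
  -- relative mass in the base, so the mean of `L` over extensions is bounded independently of `w`.
  have hmeas : ∀ l, m.real (cyl F a (w ++ [l])) ≤
      D * m.real (cyl F a w) / m.real (⋃ l, a l) * m.real (a l) := by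
    intro l
    have h1 := hD w (cyl F a (w ++ [l])) (cyl F a w) (h.measurableSet_cyl _)
      (h.measurableSet_cyl _) (h.cyl_concat_subset w l) subset_rfl
    rw [(h.iso_cyl w).bijOn.image_eq, h.cyl_concat,
      ((h.iso_cyl w).restrict (h.measurableSet l) (subset_iUnion a l)).bijOn.image_eq] at h1
    rw [h.cyl_concat, div_mul_eq_mul_div, le_div_iff₀ hY]
    linarith
  have hmaj : HasSum (fun l => p * m.real (cyl F a (w ++ [l]) \ B) +
      (q * (ρ * discountedSum L ρ w) * m.real (cyl F a (w ++ [l])) +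
        q * (D * m.real (cyl F a w) / m.real (⋃ l, a l)) * (m.real (a l) * L l)))
      (p * m.real (cyl F a w \ B) + (q * (ρ * discountedSum L ρ w) * m.real (cyl F a w) +
        q * (D * m.real (cyl F a w) / m.real (⋃ l, a l)) * ∑' l, m.real (a l) * L l)) :=
    (hμB.mul_left p).add ((hμ.mul_left _).add (hsum.hasSum.mul_left _))
  have hlt : ∀ l, m.real (cyl F a (w ++ [l])) * Z < p * m.real (cyl F a (w ++ [l]) \ B) +
      (q * (ρ * discountedSum L ρ w) * m.real (cyl F a (w ++ [l])) +
        q * (D * m.real (cyl F a w) / m.real (⋃ l, a l)) * (m.real (a l) * L l)) := by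
    intro l
    have hpos := h.measureReal_cyl_pos (w ++ [l])
    refine (mul_lt_mul_of_pos_left (hcon l) hpos).trans_le ?_
    rw [discountedSum_concat]
    have h1 : m.real (cyl F a (w ++ [l])) *
        (p * (m.real (cyl F a (w ++ [l]) \ B) / m.real (cyl F a (w ++ [l])))) =
        p * m.real (cyl F a (w ++ [l]) \ B) := by field_simp
    have h2 := mul_le_mul_of_nonneg_left (mul_le_mul_of_nonneg_right (hmeas l) (hL l)) hq
    rw [mul_add, h1]
    nlinarith [h2]
  obtain ⟨l₀⟩ : Nonempty ι := by
    by_contra hne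
    rw [not_nonempty_iff] at hne
    exact h.base_pos (by simp)
  have hfin := hasSum_lt (fun l => (hlt l).le) (hlt l₀) (hμ.mul_right Z) hmaj
  refine lt_irrefl _ (hfin.trans_eq ?_)
  rw [hZ, hK]
  field_simp

theorem exists_append_le [IsFiniteMeasure m] (h : IsFullMarkov F m a ρ C M) {D : ℝ}
    (hD : ∀ w : List ι, ∀ A B, MeasurableSet A → MeasurableSet B →
      A ⊆ cyl F a w → B ⊆ cyl F a w →
      m.real A * m.real (F^[w.length] '' B) ≤ D * (m.real B * m.real (F^[w.length] '' A)))
    {L : ι → ℝ} (hL : ∀ l, 0 ≤ L l) (hsum : Summable fun l => m.real (a l) * L l)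
    {B : Set X} (hB : MeasurableSet B) (p : ℝ) (n : ℕ) :
    ∀ w : List ι, ∃ v, p * (m.real (cyl F a v \ B) / m.real (cyl F a v)) +
        discountedSum L ρ v ≤
      p * (m.real (cyl F a w \ B) / m.real (cyl F a w)) + ρ ^ n * discountedSum L ρ w +
        D * (∑' l, m.real (a l) * L l) / m.real (⋃ l, a l) * ∑ i ∈ Finset.range n, ρ ^ i := by
  induction n with
  | zero => intro w; exact ⟨w, by simp⟩
  | succ n ih =>
    intro w
    -- The weight `ρ ^ n` is the discount that the `n` letters still to be appended will apply to
    -- the current sum.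
    obtain ⟨l, hl⟩ := h.exists_concat_le hD hL hsum hB p (pow_nonneg h.rate_pos.le n) w
    obtain ⟨v, hv⟩ := ih (w ++ [l])
    refine ⟨v, hv.trans ?_⟩
    rw [Finset.sum_range_succ, pow_succ]
    linarith

/-- There are cylinders with uniformly bounded discounted sum on which a given set of positive
measure has almost full relative measure. -/
theorem exists_cyl_diff_le_and_discountedSum_le [BorelSpace X] [IsFiniteMeasure m]
    (h : IsFullMarkov F m a ρ C M)
    {L : ι → ℝ} (hL : ∀ l, 0 ≤ L l) (hsum : Summable fun l => m.real (a l) * L l) :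
    ∃ K : ℝ, 0 < K ∧ ∀ B, MeasurableSet B → B ⊆ (⋃ l, a l) → m B ≠ 0 → ∀ η > 0,
      ∃ w : List ι, discountedSum L ρ w ≤ K ∧
        m.real (cyl F a w \ B) ≤ η * m.real (cyl F a w) := by
  obtain ⟨D, hD0, hD⟩ := h.exists_distortion_cyl
  have hΛ : 0 ≤ ∑' l, m.real (a l) * L l :=
    tsum_nonneg fun l => mul_nonneg measureReal_nonneg (hL l)
  set K₀ := D * (∑' l, m.real (a l) * L l) / m.real (⋃ l, a l) with hK₀
  have hK₀' : 0 ≤ K₀ := by positivity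
  have hρ : 0 < 1 - ρ := sub_pos.2 h.rate_lt
  have hK : 0 < K₀ * (1 - ρ)⁻¹ + 2 := by positivity
  -- The first term bounds the accumulated letter averages. The `2` pays for the initial weighted
  -- defect and for the faded initial sum, each at most `1`. With weight `K / η` on the defect, a
  -- total of at most `K` controls both quantities.
  refine ⟨K₀ * (1 - ρ)⁻¹ + 2, hK, fun B hB hBY hB0 η hη => ?_⟩
  set K := K₀ * (1 - ρ)⁻¹ + 2 with hKdef
  obtain ⟨w, hw⟩ := h.exists_measureReal_cyl_diff_le hB hBY hB0 (div_pos hη hK)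
  obtain ⟨n, hn⟩ := h.exists_pow_mul_lt (K := discountedSum L ρ w) one_pos
  obtain ⟨v, hv⟩ := h.exists_append_le hD hL hsum hB (K / η) n w
  have hwpos := h.measureReal_cyl_pos w
  have hvpos := h.measureReal_cyl_pos v
  have h1 : K / η * (m.real (cyl F a w \ B) / m.real (cyl F a w)) ≤ 1 := by
    rw [div_mul_div_comm, div_le_one (by positivity)]
    calc K * m.real (cyl F a w \ B) ≤ K * (η / K * m.real (cyl F a w)) := by gcongr
      _ = _ := by field_simp
  have h2 : K₀ * ∑ i ∈ Finset.range n, ρ ^ i ≤ K₀ * (1 - ρ)⁻¹ :=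
    mul_le_mul_of_nonneg_left (geom_partial_sum_le h.rate_pos h.rate_lt n) hK₀'
  have hvK : K / η * (m.real (cyl F a v \ B) / m.real (cyl F a v)) + discountedSum L ρ v ≤ K := by
    linarith
  have hds := discountedSum_nonneg hL h.rate_pos.le v
  have hr : 0 ≤ K / η * (m.real (cyl F a v \ B) / m.real (cyl F a v)) := by positivity
  refine ⟨v, by linarith, ?_⟩
  have h3 : K / η * (m.real (cyl F a v \ B) / m.real (cyl F a v)) ≤ K := by linarith
  rw [div_mul_div_comm, div_le_iff₀ (by positivity)] at h3
  refine le_of_mul_le_mul_left (h3.trans_eq ?_) hK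
  ring

end IsFullMarkov

/-! ### Separable open subgroups and Lipschitz extension. -/

/-- Take the closure of the subgroup generated by `S` and a countable set dense near `0`. It
contains a compact neighbourhood of `0`, hence is open, and the integer combinations form a
countable dense subset. -/
theorem exists_open_addSubgroup_subset_closure {G : Type*} [NormedAddCommGroup G]
    [LocallyCompactSpace G] {S : Set G} (hS : S.Countable) :
    ∃ Γ : AddSubgroup G, IsOpen (Γ : Set G) ∧ S ⊆ Γ ∧
      ∃ t : Set G, t.Countable ∧ (Γ : Set G) ⊆ closure t := by
  obtain ⟨K, hK, hK0⟩ := exists_compact_mem_nhds (0 : G)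
  obtain ⟨t, -, ht, hKt⟩ := EMetric.subset_countable_closure_of_compact hK
  have hc : (S ∪ t).Countable := hS.union ht
  have := hc.to_subtype
  let φ := Finsupp.linearCombination ℤ (Subtype.val : ↥(S ∪ t) → G)
  have hmem : S ∪ t ⊆ Set.range φ := by
    intro g hg
    exact ⟨Finsupp.single ⟨g, hg⟩ 1, by simp [φ]⟩
  let Γ := φ.toAddMonoidHom.range.topologicalClosure
  have hΓ : (Γ : Set G) = closure (Set.range φ) := by
    rw [AddSubgroup.topologicalClosure_coe]; rfl
  refine ⟨Γ, ?_, ?_, Set.range φ, Set.countable_range φ, hΓ.subset⟩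
  · refine Γ.isOpen_of_mem_nhds (g := 0) (mem_of_superset hK0 ?_)
    rw [hΓ]
    exact hKt.trans (closure_mono (subset_union_right.trans hmem))
  · rw [hΓ]
    exact (subset_union_left.trans hmem).trans subset_closure

/-- A Lipschitz function with values in a complete space extends to points of the closure. -/
theorem exists_lipschitz_extension {X G : Type*} [MetricSpace X] [MetricSpace G] [CompleteSpace G]
    {u : X → G} {Ω Y : Set X} (hY : Y ⊆ closure Ω) {K : ℝ} (hK : 0 ≤ K)
    (hu : ∀ x ∈ Ω, ∀ y ∈ Ω, dist (u x) (u y) ≤ K * dist x y) :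
    ∃ v : X → G, EqOn v u Ω ∧ ∀ x ∈ Y, ∀ y ∈ Y, dist (v x) (v y) ≤ K * dist x y := by
  classical
  have hlip : LipschitzOnWith K.toNNReal u Ω := LipschitzOnWith.of_dist_le_mul fun x hx y hy => by
    rw [Real.coe_toNNReal K hK]; exact hu x hx y hy
  have hlim : ∀ x, ∃ g : G, x ∈ closure Ω → Tendsto u (𝓝[Ω] x) (𝓝 g) := by
    intro x
    by_cases hx : x ∈ closure Ω
    · have : (𝓝[Ω] x).NeBot := mem_closure_iff_nhdsWithin_neBot.1 hx
      have hc : Cauchy (map u (𝓝[Ω] x)) := by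
        rw [Metric.cauchy_iff]
        refine ⟨inferInstance, fun ε hε => ?_⟩
        -- `K + 1` instead of `K` avoids dividing by zero when `K = 0`.
        have hr : 0 < ε / (2 * (K + 1)) := by positivity
        refine ⟨u '' (Ω ∩ Metric.ball x (ε / (2 * (K + 1)))), image_mem_map
          (inter_mem self_mem_nhdsWithin (mem_nhdsWithin_of_mem_nhds (Metric.ball_mem_nhds x hr))),
          ?_⟩
        rintro _ ⟨y, ⟨hy, hyx⟩, rfl⟩ _ ⟨z, ⟨hz, hzx⟩, rfl⟩
        have hyz : dist y z < ε / (K + 1) := by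
          have h1 := dist_triangle_right y z x
          have h2 : ε / (K + 1) = ε / (2 * (K + 1)) + ε / (2 * (K + 1)) := by field_simp; ring
          rw [Metric.mem_ball] at hyx hzx
          linarith
        rw [lt_div_iff₀ (by positivity)] at hyz
        have := hu y hy z hz
        nlinarith [dist_nonneg (x := y) (y := z)]
      obtain ⟨g, hg⟩ := CompleteSpace.complete hc
      exact ⟨g, fun _ => hg⟩
    · exact ⟨u x, fun h => absurd h hx⟩
  choose v hv using hlim
  refine ⟨v, fun x hx => ?_, fun x hx y hy => ?_⟩
  · have : (𝓝[Ω] x).NeBot := mem_closure_iff_nhdsWithin_neBot.1 (subset_closure hx)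
    exact tendsto_nhds_unique (hv x (subset_closure hx)) (hlip.continuousOn x hx)
  · have hx' := hY hx
    have hy' := hY hy
    have : (𝓝[Ω] x).NeBot := mem_closure_iff_nhdsWithin_neBot.1 hx'
    have : (𝓝[Ω] y).NeBot := mem_closure_iff_nhdsWithin_neBot.1 hy'
    have hfst : Tendsto (fun p : X × X => p.1) (𝓝[Ω] x ×ˢ 𝓝[Ω] y) (𝓝 x) :=
      tendsto_fst.mono_right nhdsWithin_le_nhds
    have hsnd : Tendsto (fun p : X × X => p.2) (𝓝[Ω] x ×ˢ 𝓝[Ω] y) (𝓝 y) :=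
      tendsto_snd.mono_right nhdsWithin_le_nhds
    refine le_of_tendsto_of_tendsto (((hv x hx').comp tendsto_fst).dist ((hv y hy').comp
      tendsto_snd)) ((hfst.dist hsnd).const_mul K) ?_
    filter_upwards [prod_mem_prod self_mem_nhdsWithin self_mem_nhdsWithin] with p hp
    exact hu _ hp.1 _ hp.2

/-! ### Regularity of transfer functions for full-branched maps. -/

namespace IsFullMarkov

variable {X ι G : Type*} [MetricSpace X] [MeasurableSpace X] [Countable ι]
  [NormedAddCommGroup G]
  {F : X → X} {m : Measure X} {a : ι → Set X} {ρ C M : ℝ}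

/-- A measurable transfer function takes almost all its values on the base in a separable set. -/
theorem exists_countable_closure [BorelSpace X] [IsFiniteMeasure m] [LocallyCompactSpace G]
    [MeasurableSpace G] [BorelSpace G] (h : IsFullMarkov F m a ρ C M) {L : ι → ℝ}
    (hL : ∀ l, 0 ≤ L l) {u : X → G} (hum : Measurable u) {Z : Set X} (hZY : Z ⊆ ⋃ l, a l)
    (hZ : m ((⋃ l, a l) \ Z) = 0)
    (hu : ∀ l, ∀ x ∈ a l ∩ Z, ∀ y ∈ a l ∩ Z,
      dist (u x - u (F x)) (u y - u (F y)) ≤ L l * dist (F x) (F y)) :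
    ∃ t : Set G, t.Countable ∧ ∀ᵐ x ∂m, x ∈ (⋃ l, a l) → u x ∈ closure t := by
  classical
  have hZpos : m Z ≠ 0 := fun h0 => h.base_pos <| by
    rw [← union_sdiff_cancel hZY]
    exact measure_union_null h0 hZ
  have hXne : Nonempty X := (nonempty_of_measure_ne_zero hZpos).to_type
  have hZae : ∀ᵐ x ∂m, x ∈ (⋃ l, a l) → x ∈ Z := by
    rw [ae_iff]
    refine measure_mono_null (fun x hx => ?_) hZ
    simpa using hx
  -- the increments lie in an open separable subgroup
  have hpt : ∀ q : List ι, ∃ p : X, (cyl F a q ∩ Z).Nonempty → p ∈ cyl F a q ∩ Z := by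
    intro q
    by_cases hq : (cyl F a q ∩ Z).Nonempty
    · exact ⟨hq.some, fun _ => hq.some_mem⟩
    · exact ⟨hXne.some, fun hq' => absurd hq' hq⟩
  choose pt hpt using hpt
  obtain ⟨Γ, hΓo, hΓS, t, htc, hΓt⟩ := exists_open_addSubgroup_subset_closure
    (Set.countable_range fun q : List ι => u (pt q) - u (F (pt q)))
  obtain ⟨r, hr, hrΓ⟩ := Metric.isOpen_iff.1 hΓo 0 Γ.zero_mem
  -- On a long enough cylinder the increment varies by less than `r`, so it differs by an element of
  -- `Γ` from its value at the sample point, which lies in `Γ` by construction.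
  have hinc : ∀ x ∈ Z, u x - u (F x) ∈ Γ := by
    intro x hx
    obtain ⟨l, hl⟩ := mem_iUnion.1 (hZY hx)
    obtain ⟨n, hn⟩ := h.exists_pow_mul_lt (K := L l * M) hr
    obtain ⟨w, hw, hFw⟩ := h.exists_mem_cyl n (F x) (h.mapsTo_base (hZY hx))
    have hp := hpt (l :: w) ⟨x, ⟨hl, hFw⟩, hx⟩
    set y := pt (l :: w)
    have h1 := hu l x ⟨hl, hx⟩ y ⟨hp.1.1, hp.2⟩
    have h2 := mul_le_mul_of_nonneg_left (h.dist_le_pow_of_mem_cyl w hFw hp.1.2) (hL l)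
    rw [hw] at h2
    have h3 : (u x - u (F x)) - (u y - u (F y)) ∈ Γ := by
      refine hrΓ ?_
      rw [mem_ball_zero_iff, ← dist_eq_norm]
      linarith
    have h4 : u y - u (F y) ∈ Γ := hΓS (Set.mem_range_self (l :: w))
    simpa using Γ.add_mem h3 h4
  -- the class modulo this subgroup is invariant, hence constant
  let κ : X → G ⧸ Γ := fun x => (u x : G ⧸ Γ)
  have hκ : ∀ x y, κ x = κ y ↔ -u x + u y ∈ Γ := fun x y => QuotientAddGroup.eq
  have hκF : ∀ x ∈ Z, κ (F x) = κ x := by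
    intro x hx
    rw [hκ, neg_add_eq_sub]
    exact hinc x hx
  have hdisc : DiscreteTopology (G ⧸ Γ) := QuotientAddGroup.discreteTopology hΓo
  have hκm : ∀ S : Set (G ⧸ Γ), MeasurableSet (κ ⁻¹' S) := fun S =>
    hum ((isOpen_discrete S).preimage QuotientAddGroup.continuous_mk).measurableSet
  have hzeroOne : ∀ S : Set (G ⧸ Γ), m ((⋃ l, a l) ∩ κ ⁻¹' S) ≠ 0 →
      ∀ᵐ x ∂m, x ∈ (⋃ l, a l) → κ x ∈ S := by
    intro S hS
    have h0 := h.measure_base_diff_eq_zero (h.measurableSet_base.inter (hκm S)) inter_subset_left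
      hS (by
        filter_upwards [hZae] with x hx hxY
        simp only [mem_inter_iff, mem_preimage, hκF x (hx hxY), hxY, h.mapsTo_base hxY])
    rw [ae_iff]
    refine measure_mono_null (fun x hx => ?_) h0
    simp only [mem_ofPred_eq, Classical.not_imp] at hx
    exact ⟨hx.1, fun hx' => hx.2 hx'.2⟩
  -- The discrete quotient may be uncountable, so the zero-one law alone does not make `κ` constant.
  -- Choosing a representative in `X` for each class helps: for every `n` the countably many
  -- cylinders of length `n` cover the representatives, so one of them almost surely contains `s (κ
  -- x)`. Shrinking diameters make `s ∘ κ` almost surely constant.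
  let s := Function.invFunOn κ Z
  have hsZ : ∀ x ∈ Z, s (κ x) ∈ Z := fun x hx => Function.invFunOn_mem ⟨x, hx, rfl⟩
  have hsκ : ∀ x ∈ Z, κ (s (κ x)) = κ x := fun x hx => Function.invFunOn_eq ⟨x, hx, rfl⟩
  have hcyl : ∀ n : ℕ, ∃ w : List ι, w.length = n ∧
      ∀ᵐ x ∂m, x ∈ (⋃ l, a l) → s (κ x) ∈ cyl F a w := by
    intro n
    by_contra hcon
    have hnull : ∀ w : {w : List ι // w.length = n},
        m ((⋃ l, a l) ∩ κ ⁻¹' (s ⁻¹' cyl F a w)) = 0 := by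
      intro w
      by_contra hne
      exact hcon ⟨w, w.2, hzeroOne _ hne⟩
    refine hZpos (measure_mono_null (fun x hx => ?_) (measure_iUnion_null hnull))
    obtain ⟨w, hw, hxw⟩ := h.exists_mem_cyl n _ (hZY (hsZ x hx))
    exact mem_iUnion.2 ⟨⟨w, hw⟩, hZY hx, hxw⟩
  choose w hwl hw using hcyl
  have hall : ∀ᵐ x ∂m, x ∈ (⋃ l, a l) → x ∈ Z ∧ ∀ n, s (κ x) ∈ cyl F a (w n) := by
    filter_upwards [hZae, ae_all_iff.2 hw] with x h1 h2 hx
    exact ⟨h1 hx, fun n => h2 n hx⟩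
  obtain ⟨x₀, hx₀Y, hx₀⟩ : ∃ x ∈ (⋃ l, a l), x ∈ Z ∧ ∀ n, s (κ x) ∈ cyl F a (w n) := by
    by_contra! hcon
    refine h.base_pos (measure_mono_null (fun x hx => ?_) (ae_iff.1 hall))
    simp only [mem_ofPred_eq, Classical.not_imp]
    refine ⟨hx, fun hx' => ?_⟩
    obtain ⟨n, hn⟩ := hcon x hx hx'.1
    exact hn (hx'.2 n)
  refine ⟨(u x₀ + ·) '' t, htc.image _, ?_⟩
  filter_upwards [hall] with x hx hxY
  obtain ⟨hxZ, hxc⟩ := hx hxY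
  have hs : s (κ x₀) = s (κ x) := by
    refine eq_of_forall_dist_le fun ε hε => ?_
    obtain ⟨n, hn⟩ := h.exists_pow_mul_lt (K := M) hε
    have := h.dist_le_pow_of_mem_cyl (w n) (hx₀.2 n) (hxc n)
    rw [hwl] at this
    linarith
  have hk : κ x₀ = κ x := by rw [← hsκ x hxZ, ← hs, hsκ x₀ hx₀.1]
  have hcl := hΓt ((hκ _ _).1 hk)
  have := image_closure_subset_closure_image (continuous_const_add (u x₀))
    (mem_image_of_mem _ hcl)
  simpa using this

/-- A measurable transfer function is almost everywhere Lipschitz on the base. -/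
theorem exists_ae_lipschitz [BorelSpace X] [IsFiniteMeasure m] [LocallyCompactSpace G]
    [MeasurableSpace G] [BorelSpace G] (h : IsFullMarkov F m a ρ C M) {L : ι → ℝ}
    (hL : ∀ l, 0 ≤ L l) (hsum : Summable fun l => m.real (a l) * L l)
    {u : X → G} (hum : Measurable u) {Z : Set X} (hZY : Z ⊆ ⋃ l, a l)
    (hZ : m ((⋃ l, a l) \ Z) = 0) (hZF : ∀ x ∈ Z, F x ∈ Z)
    (hu : ∀ l, ∀ x ∈ a l ∩ Z, ∀ y ∈ a l ∩ Z,
      dist (u x - u (F x)) (u y - u (F y)) ≤ L l * dist (F x) (F y)) :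
    ∃ K : ℝ, 0 < K ∧ ∃ Ω ⊆ ⋃ l, a l, m ((⋃ l, a l) \ Ω) = 0 ∧
      ∀ x ∈ Ω, ∀ y ∈ Ω, dist (u x) (u y) ≤ K * dist x y := by
  obtain ⟨t, htc, ht⟩ := h.exists_countable_closure hL hum hZY hZ hu
  obtain ⟨K, hK, hgood⟩ := h.exists_cyl_diff_le_and_discountedSum_le hL hsum
  obtain ⟨D, hD0, hD⟩ := h.exists_distortion_cyl
  -- `Z` is not assumed measurable, so its complement is enlarged to a measurable null set.
  set N := toMeasurable m ((⋃ l, a l) \ Z)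
  have hN0 : m N = 0 := (measure_toMeasurable _).trans hZ
  have hNm : MeasurableSet N := measurableSet_toMeasurable _ _
  have hNZ : (⋃ l, a l) \ N ⊆ Z := fun x hx => by
    by_contra hxZ
    exact hx.2 (subset_toMeasurable m _ ⟨hx.1, hxZ⟩)
  let B : G → ℝ → Set X := fun c ε => ((⋃ l, a l) \ N) ∩ u ⁻¹' Metric.ball c ε
  have hBm : ∀ c ε, MeasurableSet (B c ε) := fun c ε =>
    (h.measurableSet_base.diff hNm).inter (hum Metric.isOpen_ball.measurableSet)
  have hball : ∀ ε > 0, ∃ c, m (B c ε) ≠ 0 := by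
    intro ε hε
    by_contra! hcon
    have hnull : m (N ∪ ⋃ c ∈ t, B c ε) = 0 :=
      measure_union_null hN0 ((measure_biUnion_null_iff htc).2 fun c _ => hcon c)
    refine h.base_pos (measure_mono_null (fun x hx => ?_)
      (measure_union_null hnull (ae_iff.1 ht)))
    by_cases hxt : u x ∈ closure t
    · left
      by_cases hxN : x ∈ N
      · exact Or.inl hxN
      · obtain ⟨c, hc, hxc⟩ := Metric.mem_closure_iff.1 hxt ε hε
        exact Or.inr (mem_biUnion hc ⟨⟨hx, hxN⟩, hxc⟩)
    · right
      simp only [mem_ofPred_eq, Classical.not_imp]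
      exact ⟨hx, hxt⟩
  have hpow : ∀ k : ℕ, (0 : ℝ) < (1 / 2) ^ k := fun k => by positivity
  choose c hc using fun k : ℕ => hball _ (hpow k)
  choose w hwK hwB using fun k : ℕ => hgood (B (c k) ((1 / 2) ^ k)) (hBm _ _)
    (fun x hx => hx.1.1) (hc k) _ (hpow k)
  let E : ℕ → Set X := fun k =>
    F^[(w k).length] '' (cyl F a (w k) ∩ B (c k) ((1 / 2) ^ k))
  have hE : ∀ k, m.real ((⋃ l, a l) \ E k) ≤ D * (1 / 2) ^ k * m.real (⋃ l, a l) := fun k =>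
    h.measureReal_base_diff_image_le hD hD0 (w k) (hBm _ _) (hwB k)
  -- Points of `E k` are images of points where `u` is within `(1 / 2) ^ k` of `c k`, whence the
  -- error `2 * (1 / 2) ^ k`.
  have hElip : ∀ k, ∀ x ∈ E k, ∀ y ∈ E k,
      dist (u x) (u y) ≤ 2 * (1 / 2) ^ k + K * dist x y := by
    rintro k _ ⟨x, hx, rfl⟩ _ ⟨y, hy, rfl⟩
    have h1 := h.dist_iterate_le hZF hu hL (w k) x ⟨hx.1, hNZ hx.2.1⟩ y ⟨hy.1, hNZ hy.2.1⟩
    have h2 := mul_le_mul_of_nonneg_right (hwK k)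
      (dist_nonneg (x := F^[(w k).length] x) (y := F^[(w k).length] y))
    have h3 : dist (u x) (c k) < (1 / 2) ^ k := hx.2.2
    have h4 : dist (u y) (c k) < (1 / 2) ^ k := hy.2.2
    have h5 := dist_triangle_right (u x) (u y) (c k)
    linarith
  have hsumE : ∑' k, m ((⋃ l, a l) \ E k) ≠ ∞ := by
    have hs : Summable fun k : ℕ => D * (1 / 2 : ℝ) ^ k * m.real (⋃ l, a l) :=
      ((summable_geometric_of_lt_one (by norm_num) (by norm_num)).mul_left D).mul_right _
    refine ne_top_of_le_ne_top hs.tsum_ofReal_ne_top (ENNReal.tsum_le_tsum fun k => ?_)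
    rw [← ofReal_measureReal (measure_ne_top m _)]
    exact ENNReal.ofReal_le_ofReal (hE k)
  have hBC := ae_eventually_notMem hsumE
  refine ⟨K, hK, {x | x ∈ (⋃ l, a l) ∧ ∀ᶠ k in atTop, x ∉ (⋃ l, a l) \ E k}, fun x hx => hx.1,
    measure_mono_null (fun x hx => ?_) (ae_iff.1 hBC), fun x hx y hy => ?_⟩
  · exact fun hx' => hx.2 ⟨hx.1, hx'⟩
  · have hlim : Tendsto (fun k : ℕ => 2 * (1 / 2 : ℝ) ^ k + K * dist x y) atTop
        (𝓝 (2 * 0 + K * dist x y)) :=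
      ((tendsto_pow_atTop_nhds_zero_of_lt_one (by norm_num) (by norm_num)).const_mul 2).add_const _
    rw [mul_zero, zero_add] at hlim
    refine ge_of_tendsto hlim ?_
    filter_upwards [hx.2, hy.2] with k hxk hyk
    refine hElip k x ?_ y ?_
    · by_contra hx'; exact hxk ⟨hx.1, hx'⟩
    · by_contra hy'; exact hyk ⟨hy.1, hy'⟩

/-- Every cylinder has positive measure, so it meets `Ω`, and cylinders around a given point shrink
to it. -/
theorem base_subset_closure (h : IsFullMarkov F m a ρ C M) {Ω : Set X}
    (hΩ : m ((⋃ l, a l) \ Ω) = 0) : (⋃ l, a l) ⊆ closure Ω := by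
  intro x hx
  refine Metric.mem_closure_iff.2 fun ε hε => ?_
  obtain ⟨n, hn⟩ := h.exists_pow_mul_lt (K := M) hε
  obtain ⟨w, hw, hxw⟩ := h.exists_mem_cyl n x hx
  obtain ⟨y, hyw, hy⟩ : (cyl F a w ∩ Ω).Nonempty := by
    by_contra hne
    refine h.measure_cyl_ne_zero w (measure_mono_null (fun y hy => ?_) hΩ)
    exact ⟨cyl_subset_base w hy, fun hyΩ => hne ⟨y, hy, hyΩ⟩⟩
  rw [← hw] at hn
  exact ⟨y, hy, (h.dist_le_pow_of_mem_cyl w hxw hyw).trans_lt hn⟩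

/-- Regularity of transfer functions: if the coboundary of `u` is Lipschitz on each branch, with
summable constants, then `u` has a version that is Lipschitz on the base. -/
theorem exists_lipschitz_version [BorelSpace X] [IsFiniteMeasure m] [LocallyCompactSpace G]
    [MeasurableSpace G] [BorelSpace G] (h : IsFullMarkov F m a ρ C M) {L : ι → ℝ}
    (hL : ∀ l, 0 ≤ L l) (hsum : Summable fun l => m.real (a l) * L l)
    {u : X → G} (hum : AEMeasurable u m) {p : X → Prop}
    (hp : ∀ᵐ x ∂m, x ∈ (⋃ l, a l) → p x)
    (hu : ∀ l, ∀ x ∈ a l, ∀ y ∈ a l, p x → p y →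
      dist (u x - u (F x)) (u y - u (F y)) ≤ L l * dist (F x) (F y)) :
    ∃ v : X → G, (∀ᵐ x ∂m, v x = u x) ∧ ∃ K : ℝ, 0 < K ∧
      ∀ x ∈ (⋃ l, a l), ∀ y ∈ (⋃ l, a l), dist (v x) (v y) ≤ K * dist x y := by
  classical
  have : CompleteSpace G := IsRightUniformAddGroup.completeSpace_of_weaklyLocallyCompactSpace
  let q : X → Prop := fun x => p x ∧ u x = hum.mk u x
  have hq : ∀ᵐ x ∂m, x ∈ (⋃ l, a l) → q x := by
    filter_upwards [hp, hum.ae_eq_mk] with x h1 h2 hx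
    exact ⟨h1 hx, h2⟩
  -- Requiring `q` along the whole orbit makes `Z` forward invariant, as iteration along words
  -- demands.
  let Z : Set X := {x | x ∈ (⋃ l, a l) ∧ ∀ n, q (F^[n] x)}
  have hZY : Z ⊆ ⋃ l, a l := fun x hx => hx.1
  have hZ : m ((⋃ l, a l) \ Z) = 0 := by
    refine measure_mono_null (fun x hx => ?_) (ae_iff.1 (ae_all_iff.2 (h.ae_comp_iterate hq)))
    exact fun hx' => hx.2 ⟨hx.1, fun n => hx' n hx.1⟩
  have hZF : ∀ x ∈ Z, F x ∈ Z := fun x hx =>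
    ⟨h.mapsTo_base hx.1, fun n => by simpa only [Function.iterate_succ_apply] using hx.2 (n + 1)⟩
  have hZu : ∀ l, ∀ x ∈ a l ∩ Z, ∀ y ∈ a l ∩ Z,
      dist (hum.mk u x - hum.mk u (F x)) (hum.mk u y - hum.mk u (F y)) ≤
        L l * dist (F x) (F y) := by
    rintro l x ⟨hxl, hxZ⟩ y ⟨hyl, hyZ⟩
    have hz : ∀ z ∈ Z, hum.mk u z = u z ∧ hum.mk u (F z) = u (F z) := fun z hz =>
      ⟨(hz.2 0).2.symm, (hz.2 1).2.symm⟩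
    rw [(hz x hxZ).1, (hz x hxZ).2, (hz y hyZ).1, (hz y hyZ).2]
    exact hu l x hxl y hyl (hxZ.2 0).1 (hyZ.2 0).1
  obtain ⟨K, hK, Ω, hΩY, hΩ, hlip⟩ :=
    h.exists_ae_lipschitz hL hsum hum.measurable_mk hZY hZ hZF hZu
  obtain ⟨v, hvΩ, hv⟩ := exists_lipschitz_extension (h.base_subset_closure hΩ) hK.le hlip
  refine ⟨(⋃ l, a l).piecewise v u, ?_, K, hK, fun x hx y hy => ?_⟩
  · have hΩae : ∀ᵐ x ∂m, x ∉ (⋃ l, a l) \ Ω := measure_eq_zero_iff_ae_notMem.1 hΩ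
    filter_upwards [hΩae, hum.ae_eq_mk] with x hx hxu
    by_cases hxY : x ∈ ⋃ l, a l
    · rw [piecewise_eq_of_mem _ _ _ hxY, hxu]
      exact hvΩ (by_contra fun hxΩ => hx ⟨hxY, hxΩ⟩)
    · rw [piecewise_eq_of_notMem _ _ _ hxY]
  · rw [piecewise_eq_of_mem _ _ _ hx, piecewise_eq_of_mem _ _ _ hy]
    exact hv x hx y hy

end IsFullMarkov

/-! ### The return map of a Young tower. -/

/-- The return map to the base of a tower, extended by the identity. -/
noncomputable def returnMap {X ι : Type*} (T : X → X) (R : ι → ℕ) (Δ : ℕ → ι → Set X) (x : X) : X :=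
  open Classical in if h : ∃ l, x ∈ Δ 0 l then T^[R h.choose] x else x

/-- Integrate `1 / g y ≤ κ * (1 / g x)` over `x ∈ A` and `y ∈ B`. -/
theorem measure_mul_measure_image_le_of_density {X : Type*} [MeasurableSpace X] {T : X → X}
    {m : Measure X} [IsFiniteMeasure m] {g : X → ℝ} {A B : Set X}
    (hA : MeasurableSet A) (hB : MeasurableSet B)
    (hTA : m (T '' A) = ∫⁻ x in A, ENNReal.ofReal (1 / g x) ∂m)
    (hTB : m (T '' B) = ∫⁻ x in B, ENNReal.ofReal (1 / g x) ∂m)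
    {κ : ℝ} (hκ : 0 ≤ κ) (hgA : ∀ x ∈ A, 0 < g x) (hgB : ∀ x ∈ B, 0 < g x)
    (hg : ∀ x ∈ A, ∀ y ∈ B, g x / g y ≤ κ) :
    m.real A * m.real (T '' B) ≤ κ * (m.real B * m.real (T '' A)) := by
  have h1 : ∀ x ∈ A, m (T '' B) ≤ ENNReal.ofReal κ * ENNReal.ofReal (1 / g x) * m B := by
    intro x hx
    rw [hTB, ← setLIntegral_const]
    refine setLIntegral_mono' hB fun y hy => ?_
    rw [← ENNReal.ofReal_mul hκ]
    refine ENNReal.ofReal_le_ofReal ?_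
    have := hg x hx y hy
    have hx0 := hgA x hx
    have hy0 := hgB y hy
    rw [div_le_iff₀ hy0] at this
    rw [mul_one_div, div_le_div_iff₀ hy0 hx0]
    linarith
  have h2 : m A * m (T '' B) ≤ ENNReal.ofReal κ * (m B * m (T '' A)) := by
    calc m A * m (T '' B) = ∫⁻ _ in A, m (T '' B) ∂m := by rw [setLIntegral_const, mul_comm]
      _ ≤ ∫⁻ x in A, ENNReal.ofReal κ * m B * ENNReal.ofReal (1 / g x) ∂m :=
          setLIntegral_mono' hA fun x hx => (h1 x hx).trans_eq (mul_right_comm _ _ _)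
      _ = ENNReal.ofReal κ * m B * m (T '' A) := by
          rw [lintegral_const_mul' _ _ (ENNReal.mul_ne_top ENNReal.ofReal_ne_top
            (measure_ne_top m B)), hTA]
      _ = _ := mul_assoc _ _ _
  have h3 := ENNReal.toReal_mono (ENNReal.mul_ne_top ENNReal.ofReal_ne_top
    (ENNReal.mul_ne_top (measure_ne_top m B) (measure_ne_top m _))) h2
  rwa [ENNReal.toReal_mul, ENNReal.toReal_mul, ENNReal.toReal_mul, ENNReal.toReal_ofReal hκ] at h3

namespace IsYoungTower

variable {X ι : Type*} [MetricSpace X] [MeasurableSpace X]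
  {T : X → X} {m : Measure X} {R : ι → ℕ} {Δ : ℕ → ι → Set X}

theorem returnMap_eq (h : IsYoungTower T m R Δ) {l : ι} {x : X} (hx : x ∈ Δ 0 l) :
    returnMap T R Δ x = T^[R l] x := by
  have hex : ∃ l, x ∈ Δ 0 l := ⟨l, hx⟩
  have hl : hex.choose = l := by
    by_contra hne
    exact (h.disjoint hex.choose l 0 (h.height_pos _) 0 (h.height_pos l)
      (by simpa using hne)).le_bot ⟨hex.choose_spec, hx⟩
  rw [returnMap, dif_pos hex, hl]

theorem iso_iterate (h : IsYoungTower T m R Δ) (l : ι) (k : ℕ) (hk : k < R l) :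
    IsMeasurableIsoOn T^[k] (Δ 0 l) (Δ k l) := by
  induction k with
  | zero => exact isMeasurableIsoOn_id (h.measurableSet l 0 hk)
  | succ k ih =>
    rw [Function.iterate_succ']
    exact (h.up_iso l k hk).comp (ih (by omega))

theorem measure_image_iterate (h : IsYoungTower T m R Δ) (l : ι) (k : ℕ) (hk : k < R l)
    {A : Set X} (hA : MeasurableSet A) (hAl : A ⊆ Δ 0 l) : m (T^[k] '' A) = m A := by
  induction k with
  | zero => simp
  | succ k ih =>
    have hiso := h.iso_iterate l k (by omega)
    rw [Function.iterate_succ', image_comp, h.up_measure l k hk _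
      (hiso.measurableSet_image A hA hAl) ((image_mono hAl).trans hiso.bijOn.image_eq.subset),
      ih (by omega)]

theorem measure_level (h : IsYoungTower T m R Δ) (l : ι) (k : ℕ) (hk : k < R l) :
    m (Δ k l) = m (Δ 0 l) := by
  rw [← h.measure_image_iterate l k hk (h.measurableSet l 0 (h.height_pos l)) subset_rfl,
    (h.iso_iterate l k hk).bijOn.image_eq]

theorem image_iterate_height (h : IsYoungTower T m R Δ) (l : ι) (A : Set X) :
    T^[R l] '' A = T '' (T^[R l - 1] '' A) := by
  obtain ⟨n, hn⟩ := Nat.exists_eq_succ_of_ne_zero (h.height_pos l).ne'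
  rw [hn, Nat.succ_sub_one, Function.iterate_succ', image_comp]

theorem iso_iterate_height (h : IsYoungTower T m R Δ) (l : ι) :
    IsMeasurableIsoOn T^[R l] (Δ 0 l) (⋃ l, Δ 0 l) := by
  have hR := h.height_pos l
  have := (h.top_iso l).comp (h.iso_iterate l (R l - 1) (by omega))
  rwa [← Function.iterate_succ', Nat.succ_eq_add_one, Nat.sub_add_cancel hR] at this

theorem measure_inter_preimage_iterate_eq_zero (h : IsYoungTower T m R Δ) (l : ι) (k : ℕ)
    (hk : k < R l) {N : Set X} (hN : m (Δ k l ∩ N) = 0) : m (Δ 0 l ∩ T^[k] ⁻¹' N) = 0 := by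
  have hiso := h.iso_iterate l k hk
  set E := toMeasurable m (Δ k l ∩ N) ∩ Δ k l
  have hE : MeasurableSet E := (measurableSet_toMeasurable _ _).inter (h.measurableSet l k hk)
  have hE0 : m E = 0 := measure_mono_null inter_subset_left ((measure_toMeasurable _).trans hN)
  have hres := hiso.restrict hE inter_subset_right
  have h0 : m (Δ 0 l ∩ T^[k] ⁻¹' E) = 0 := by
    rw [← h.measure_image_iterate l k hk (hiso.measurableSet_preimage E hE inter_subset_right)
      inter_subset_left, hres.bijOn.image_eq, hE0]
  have hsub : Δ 0 l ∩ T^[k] ⁻¹' N ⊆ Δ 0 l ∩ T^[k] ⁻¹' E := fun x hx =>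
    have hxk := hiso.bijOn.mapsTo hx.1
    ⟨hx.1, subset_toMeasurable m _ ⟨hxk, hx.2⟩, hxk⟩
  exact measure_mono_null hsub h0

/-- Each level has the mass of the bottom of its column, so a null base would make `X` null. -/
theorem measure_base_ne_zero [Countable ι] [IsProbabilityMeasure m] (h : IsYoungTower T m R Δ) :
    m (⋃ l, Δ 0 l) ≠ 0 := by
  intro h0
  have hlev : ∀ l, m (⋃ k : {k // k < R l}, Δ k l) = 0 := fun l =>
    measure_iUnion_null fun k => (h.measure_level l k k.2).trans
      (measure_mono_null (subset_iUnion (Δ 0) l) h0)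
  refine IsProbabilityMeasure.ne_zero m (Measure.measure_univ_eq_zero.1 ?_)
  refine measure_mono_null (fun x _ => ?_) (measure_iUnion_null hlev)
  obtain ⟨l, k, hk, hx⟩ := h.cover x
  exact mem_iUnion.2 ⟨l, mem_iUnion.2 ⟨⟨k, hk⟩, hx⟩⟩

theorem tsum_measure_level_le [Countable ι] (h : IsYoungTower T m R Δ) :
    ∑' l, ∑ k ∈ Finset.range (R l), m (Δ k l) ≤ m univ := by
  have hmeas : ∀ l, MeasurableSet (⋃ k ∈ Finset.range (R l), Δ k l) := fun l =>
    Finset.measurableSet_biUnion _ fun k hk => h.measurableSet l k (Finset.mem_range.1 hk)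
  have hsum : ∀ l, ∑ k ∈ Finset.range (R l), m (Δ k l) = m (⋃ k ∈ Finset.range (R l), Δ k l) := by
    intro l
    refine (measure_biUnion_finset (fun k hk k' hk' hne => ?_) fun k hk =>
      h.measurableSet l k (Finset.mem_range.1 hk)).symm
    exact h.disjoint l l k (Finset.mem_range.1 hk) k' (Finset.mem_range.1 hk')
      fun e => hne (Prod.ext_iff.1 e).1
  simp only [hsum]
  rw [← measure_iUnion (fun l l' hne => ?_) hmeas]
  · exact measure_mono (subset_univ _)
  · simp only [Function.onFun, disjoint_iUnion_left, disjoint_iUnion_right, Finset.mem_range]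
    exact fun k' hk' k hk => h.disjoint l l' _ ‹_› _ ‹_› fun e => hne (Prod.ext_iff.1 e).2

/-- The return map to the base of a Young tower is a full-branched Markov map with bounded
distortion. -/
theorem exists_isFullMarkov [BoundedSpace X] [Countable ι] [IsProbabilityMeasure m]
    (h : IsYoungTower T m R Δ) :
    ∃ ρ C M : ℝ, IsFullMarkov (returnMap T R Δ) m (fun l => Δ 0 l) ρ C M := by
  obtain ⟨lam, hlam, hexp⟩ := h.expansion
  obtain ⟨g, hgm, hgpos, hgint, C, hC, hgC⟩ := h.distortion
  have heq : ∀ l, EqOn T^[R l] (returnMap T R Δ) (Δ 0 l) := fun l x hx => (h.returnMap_eq hx).symm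
  have himg : ∀ l, ∀ A ⊆ Δ 0 l, returnMap T R Δ '' A = T '' (T^[R l - 1] '' A) := by
    intro l A hA
    rw [← ((heq l).mono hA).image_eq, h.image_iterate_height]
  have htop : ∀ l, R l - 1 < R l := fun l => Nat.sub_lt (h.height_pos l) one_pos
  have hsub : ∀ l, ∀ A ⊆ Δ 0 l, T^[R l - 1] '' A ⊆ Δ (R l - 1) l := fun l A hA =>
    (image_mono hA).trans (h.iso_iterate l _ (htop l)).bijOn.image_eq.subset
  have hmeas : ∀ l, ∀ A, MeasurableSet A → A ⊆ Δ 0 l → MeasurableSet (T^[R l - 1] '' A) :=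
    fun l A hA hAl => (h.iso_iterate l _ (htop l)).measurableSet_image A hA hAl
  have hmas : ∀ l, ∀ A, MeasurableSet A → A ⊆ Δ 0 l → m (T^[R l - 1] '' A) = m A :=
    fun l A hA hAl => h.measure_image_iterate l _ (htop l) hA hAl
  refine ⟨lam⁻¹, C, Metric.diam (univ : Set X), ?_⟩
  refine
    { rate_pos := by positivity
      rate_lt := inv_lt_one_of_one_lt₀ hlam
      distortion_nonneg := hC.le
      diam_nonneg := Metric.diam_nonneg
      dist_le := fun x y => Metric.dist_le_diam_of_mem (Bornology.IsBounded.all _) (mem_univ x)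
        (mem_univ y)
      measurableSet := fun l => h.measurableSet l 0 (h.height_pos l)
      disjoint := fun l l' hne => h.disjoint l l' 0 (h.height_pos l) 0 (h.height_pos l')
        (by simpa using hne)
      iso := fun l => (h.iso_iterate_height l).congr (heq l)
      contraction := ?_
      distortion := ?_
      null_image := ?_
      base_pos := h.measure_base_ne_zero }
  · intro l x hx y hy
    rw [h.returnMap_eq hx, h.returnMap_eq hy, inv_mul_eq_div, le_div_iff₀ (by linarith), mul_comm]
    exact hexp l x hx y hy
  · intro l A B hA hB hAl hBl δ hδ hd
    rw [himg l A hAl, himg l B hBl, measureReal_def m A, ← hmas l A hA hAl, measureReal_def m B,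
      ← hmas l B hB hBl]
    refine measure_mul_measure_image_le_of_density (hmeas l A hA hAl) (hmeas l B hB hBl)
      (hgint l _ (hmeas l A hA hAl) (hsub l A hAl)) (hgint l _ (hmeas l B hB hBl) (hsub l B hBl))
      (by positivity) (fun x hx => hgpos l x (hsub l A hAl hx))
      (fun x hx => hgpos l x (hsub l B hBl hx)) fun x hx y hy => ?_
    have h1 := hgC l x (hsub l A hAl hx) y (hsub l B hBl hy)
    have h2 : dist (T x) (T y) ≤ δ := by
      have hTx := mem_image_of_mem T hx
      have hTy := mem_image_of_mem T hy
      rw [← himg l A hAl] at hTx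
      rw [← himg l B hBl] at hTy
      obtain ⟨x', hx', hxe⟩ := hTx
      obtain ⟨y', hy', hye⟩ := hTy
      rw [← hxe, ← hye]
      exact hd x' hx' y' hy'
    have h3 := mul_le_mul_of_nonneg_left h2 hC.le
    have h4 := neg_abs_le (1 - g x / g y)
    linarith
  · intro l A hA hAl
    have hg' : Measurable fun x => ENNReal.ofReal (1 / g x) :=
      (measurable_const.div hgm).ennreal_ofReal
    rw [himg l A hAl, hgint l _ (hmeas l A hA hAl) (hsub l A hAl), ← hmas l A hA hAl,
      -- Since `1 / g` is positive on the top level, its integral over a set vanishes only if the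
      -- set is null.
      ← not_iff_not, ← ne_eq, ← ne_eq, ← pos_iff_ne_zero, ← pos_iff_ne_zero,
      setLIntegral_pos_iff hg']
    rw [inter_eq_right.2 fun x hx => ?_]
    have := hgpos l x (hsub l A hAl hx)
    simpa using this

end IsYoungTower

/-! ### From the tower to its return map. -/

/-- The infimum need not be attained. The slack `1` is harmless in the weighted sum because the
levels have finite total mass. -/
theorem exists_lipschitz_of_essLip_ne_top {X G : Type*} [MetricSpace X] [MeasurableSpace X]
    [MetricSpace G] {m : Measure X} {f : X → G} {Z : Set X} (h : essLip m f Z ≠ ∞) :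
    ∃ C : ℝ, 0 < C ∧ ENNReal.ofReal C ≤ essLip m f Z + 1 ∧
      ∃ Ω, m (Z \ Ω) = 0 ∧ ∀ x ∈ Ω, ∀ y ∈ Ω, dist (f x) (f y) ≤ C * dist x y := by
  have hlt : essLip m f Z < essLip m f Z + 1 := ENNReal.lt_add_right h one_ne_zero
  obtain ⟨_, ⟨C, hC, rfl, Ω, -, hΩ⟩, hlt⟩ := sInf_lt_iff.1 hlt
  exact ⟨C, hC, hlt.le, Ω, hΩ⟩

/-- Regularity of coboundaries over Young towers, for values in a normed group. -/
theorem IsYoungTower.exists_lipschitz_version {X ι G : Type*} [Countable ι]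
    [MetricSpace X] [BoundedSpace X] [MeasurableSpace X] [BorelSpace X]
    [NormedAddCommGroup G] [LocallyCompactSpace G] [MeasurableSpace G] [BorelSpace G]
    {m : Measure X} [IsProbabilityMeasure m] {T : X → X} {R : ι → ℕ} {Δ : ℕ → ι → Set X}
    (tower : IsYoungTower T m R Δ) {f : X → G}
    (sum_lt : ∑' l, ∑ k ∈ Finset.range (R l), m (Δ k l) * essLip m f (Δ k l) < ∞)
    {u : X → G} (hu : AEMeasurable u m) (hfu : ∀ᵐ x ∂m, f x = u x - u (T x)) :
    ∃ v : X → G, (∀ᵐ x ∂m, v x = u x) ∧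
      ∃ C : ℝ, 0 < C ∧ ∀ x ∈ towerBase Δ, ∀ y ∈ towerBase Δ,
        dist (v x) (v y) ≤ C * dist x y := by
  obtain ⟨ρ, C, M, hF⟩ := tower.exists_isFullMarkov
  obtain ⟨C', hC', hret⟩ := tower.return_control
  have hlevel : ∀ l, m (Δ 0 l) ≠ 0 := by
    intro l
    rw [ne_eq, ← hF.null_image l _ (hF.measurableSet l) subset_rfl, (hF.iso l).bijOn.image_eq]
    exact hF.base_pos
  have hess : ∀ l k, ∃ c : ℝ, 0 ≤ c ∧ (k < R l → ENNReal.ofReal c ≤ essLip m f (Δ k l) + 1) ∧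
      ∃ Ω : Set X, (k < R l → m (Δ k l \ Ω) = 0 ∧
        ∀ x ∈ Ω, ∀ y ∈ Ω, dist (f x) (f y) ≤ c * dist x y) := by
    intro l k
    by_cases hk : k < R l
    · have h1 : m (Δ k l) * essLip m f (Δ k l) ≠ ∞ :=
        ne_top_of_le_ne_top sum_lt.ne ((Finset.single_le_sum
          (f := fun k => m (Δ k l) * essLip m f (Δ k l)) (fun _ _ => zero_le)
          (Finset.mem_range.2 hk)).trans (ENNReal.le_tsum l))
      -- Every level has positive mass, so an infinite constant would make its term infinite.
      have h2 : essLip m f (Δ k l) ≠ ∞ := fun htop => h1 <| by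
        rw [htop, ENNReal.mul_top]
        rw [tower.measure_level l k hk]
        exact hlevel l
      obtain ⟨c, hc, hce, Ω, hΩ⟩ := exists_lipschitz_of_essLip_ne_top h2
      exact ⟨c, hc.le, fun _ => hce, Ω, fun _ => hΩ⟩
    · exact ⟨0, le_rfl, fun h => absurd h hk, ∅, fun h => absurd h hk⟩
  choose c hc hce Ω hΩ using hess
  have hL : ∀ l, 0 ≤ C' * ∑ k ∈ Finset.range (R l), c l k := fun l =>
    mul_nonneg hC'.le (Finset.sum_nonneg fun k _ => hc l k)
  have hsum : Summable fun l => m.real (Δ 0 l) * (C' * ∑ k ∈ Finset.range (R l), c l k) := by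
    have hterm : ∀ l, ENNReal.ofReal (m.real (Δ 0 l) * (C' * ∑ k ∈ Finset.range (R l), c l k)) ≤
        ENNReal.ofReal C' * (∑ k ∈ Finset.range (R l), m (Δ k l) * essLip m f (Δ k l) +
          ∑ k ∈ Finset.range (R l), m (Δ k l)) := by
      intro l
      rw [mul_left_comm, ENNReal.ofReal_mul hC'.le, ENNReal.ofReal_mul measureReal_nonneg,
        ofReal_measureReal (measure_ne_top m _), ENNReal.ofReal_sum_of_nonneg fun k _ => hc l k,
        Finset.mul_sum, ← Finset.sum_add_distrib]
      refine mul_le_mul_right (Finset.sum_le_sum fun k hk => ?_) _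
      have hk' := Finset.mem_range.1 hk
      rw [← tower.measure_level l k hk', ← mul_add_one]
      exact mul_le_mul_right (hce l k hk') _
    have hfin : ∑' l, ENNReal.ofReal (m.real (Δ 0 l) *
        (C' * ∑ k ∈ Finset.range (R l), c l k)) ≠ ∞ := by
      refine ne_top_of_le_ne_top ?_ (ENNReal.tsum_le_tsum hterm)
      rw [ENNReal.tsum_mul_left, ENNReal.tsum_add]
      exact ENNReal.mul_ne_top ENNReal.ofReal_ne_top (ENNReal.add_ne_top.2
        ⟨sum_lt.ne, ne_top_of_le_ne_top (measure_ne_top m _) tower.tsum_measure_level_le⟩)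
    refine (ENNReal.summable_toReal hfin).congr fun l => ?_
    rw [ENNReal.toReal_ofReal (mul_nonneg measureReal_nonneg (hL l))]
  -- Good points: their whole climb through the column stays in the full-measure sets where `f` is
  -- Lipschitz and the coboundary equation holds.
  let p : X → Prop := fun x => ∀ l, x ∈ Δ 0 l → ∀ k, k < R l →
    T^[k] x ∈ Ω l k ∧ f (T^[k] x) = u (T^[k] x) - u (T^[k + 1] x)
  have hp : ∀ᵐ x ∂m, x ∈ (⋃ l, Δ 0 l) → p x := by
    have hall : ∀ᵐ x ∂m, p x := by
      refine ae_all_iff.2 fun l => ?_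
      have hk : ∀ k, ∀ᵐ x ∂m, x ∈ Δ 0 l → k < R l →
          T^[k] x ∈ Ω l k ∧ f (T^[k] x) = u (T^[k] x) - u (T^[k + 1] x) := by
        intro k
        by_cases hk : k < R l
        · have hN : m (Δ k l ∩ {y | ¬ (y ∈ Ω l k ∧ f y = u y - u (T y))}) = 0 := by
            refine measure_mono_null (fun y hy => ?_) (measure_union_null (hΩ l k hk).1
              (ae_iff.1 hfu))
            by_cases hyΩ : y ∈ Ω l k
            · exact Or.inr fun hyf => hy.2 ⟨hyΩ, hyf⟩
            · exact Or.inl ⟨hy.1, hyΩ⟩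
          rw [ae_iff]
          refine measure_mono_null (fun x hx => ?_)
            (tower.measure_inter_preimage_iterate_eq_zero l k hk hN)
          simp only [mem_ofPred_eq, Classical.not_imp, Function.iterate_succ_apply'] at hx
          exact ⟨hx.1, hx.2.2⟩
        · exact Eventually.of_forall fun x _ h => absurd h hk
      filter_upwards [ae_all_iff.2 hk] with x hx hxl k hkR
      exact hx k hxl hkR
    filter_upwards [hall] with x hx _
    exact hx
  refine hF.exists_lipschitz_version hL hsum hu hp fun l x hx y hy hpx hpy => ?_
  rw [tower.returnMap_eq hx, tower.returnMap_eq hy]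
  have hbirk : ∀ z ∈ Δ 0 l, p z →
      u z - u (T^[R l] z) = ∑ k ∈ Finset.range (R l), f (T^[k] z) := by
    intro z hz hpz
    rw [Finset.sum_congr rfl fun k hk => (hpz l hz k (Finset.mem_range.1 hk)).2,
      Finset.sum_range_sub' fun k => u (T^[k] z)]
    rfl
  rw [hbirk x hx hpx, hbirk y hy hpy]
  refine (dist_sum_sum_le _ _ _).trans ?_
  rw [mul_right_comm, Finset.mul_sum]
  refine Finset.sum_le_sum fun k hk => ?_
  have hkR := Finset.mem_range.1 hk
  have hiso := tower.iso_iterate l k hkR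
  have h1 := (hΩ l k hkR).2 _ (hpx l hx k hkR).1 _ (hpy l hy k hkR).1
  have h2 := hret l k hkR _ (hiso.bijOn.mapsTo hx) _ (hiso.bijOn.mapsTo hy)
  rw [← Function.iterate_add_apply, ← Function.iterate_add_apply, Nat.sub_add_cancel hkR.le] at h2
  calc dist (f (T^[k] x)) (f (T^[k] y)) ≤ c l k * dist (T^[k] x) (T^[k] y) := h1
    _ ≤ c l k * (C' * dist (T^[R l] x) (T^[R l] y)) := mul_le_mul_of_nonneg_left h2 (hc l k)
    _ = _ := mul_comm _ _

theorem theorem2 {X ι G : Type*} [Countable ι]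
    [MetricSpace X] [BoundedSpace X] [MeasurableSpace X] [BorelSpace X]
    [AddCommGroup G] [MetricSpace G] [LocallyCompactSpace G]
    [MeasurableSpace G] [BorelSpace G]
    (dist_add : ∀ a b c : G, dist (a + c) (b + c) = dist a b)
    (m : Measure X) [IsProbabilityMeasure m]
    (T : X → X) (R : ι → ℕ) (Δ : ℕ → ι → Set X)
    (tower : IsYoungTower T m R Δ)
    (f : X → G)
    (sum_lt : ∑' l, ∑ k ∈ Finset.range (R l), m (Δ k l) * essLip m f (Δ k l) < ∞)
    (u : X → G) (hu : AEMeasurable u m)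
    (hfu : ∀ᵐ x ∂m, f x = u x - u (T x)) :
    ∃ v : X → G, (∀ᵐ x ∂m, v x = u x) ∧
      ∃ C : ℝ, 0 < C ∧ ∀ x ∈ towerBase Δ, ∀ y ∈ towerBase Δ,
        dist (v x) (v y) ≤ C * dist x y := by
  -- The norm is the distance to `0`. The given metric is kept, so topology and Borel structure are
  -- unchanged.
  let _ : NormedAddCommGroup G :=
    { ‹AddCommGroup G›, ‹MetricSpace G› with
      norm := fun g => dist g 0
      dist_eq := fun x y => by
        change dist x y = dist (-x + y) 0
        rw [← dist_add (-x + y) 0 x, dist_comm x y]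
        congr 1 <;> abel }
  exact tower.exists_lipschitz_version sum_lt hu hfu
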